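/- Let $p$ be a prime number, let $K\subseteq L$ be a finite extension of fields of characteristic $p$, and let $R$ be a commutative $K$-algebra of finite type. Put $S:=R\otimes_K L$, and assume that the map $R\to S$ has regular fibers, i.e. that $\kappa(\mathfrak p)\otimes_R S$ is a regular ring for every prime ideal $\mathfrak p$ of $R$. If $R$ is $F$-rational and $F$-pure, then $S$ is $F$-rational and $F$-pure. Here a ring is called $F$-rational (resp. $F$-pure) if its localizations at all prime ideals are. A noetherian local ring $(A,\mathfrak m)$ of characteristic $p$ is $F$-rational if it is Cohen–Macaulay and $I=I^*$ for every ideal $I$ generated by part of a system of parameters, where $$I^*=\{r\in A\mid \exists\, c\in A \text{ in no minimal prime of } A \text{ such that } c\,r^{p^e}\in I^{[p^e]} \text{ for all } e\gg 0\},\qquad I^{[q]}=(a^q\mid a\in I),$$ is the tight closure of $I$. It is $F$-pure if its Frobenius endomorphism is pure, i.e. remains injective after tensoring with any $A$-module; if the Frobenius endomorphism is finite, this means that it splits. -/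

import Mathlib

open scoped TensorProduct

universe u v w

namespace FSing

section LocalAlgebra

variable (A : Type u) [CommRing A] [IsLocalRing A]

/-- A list `x₁, …, x_d` of elements of a local ring `(A, 𝔪)` is a (full) system of parameters
if `d = dim A` and `√(x₁, …, x_d) = 𝔪`. -/
def IsSystemOfParameters (xs : List A) : Prop :=
  (xs.length : WithBot ℕ∞) = ringKrullDim A ∧
    (Ideal.ofList xs).radical = IsLocalRing.maximalIdeal A

/-- A parameter ideal of a local ring: an ideal generated by part of a system of parameters
(the empty part is allowed and generates the zero ideal). -/
def IsParameterIdeal (I : Ideal A) : Prop :=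
  ∃ xs ys : List A, IsSystemOfParameters A (xs ++ ys) ∧ I = Ideal.ofList xs

/-- A local ring is Cohen--Macaulay if it is noetherian and has a regular sequence of length
its Krull dimension. (A regular sequence generates a proper ideal, so it lies in the maximal
ideal.) -/
structure IsCohenMacaulayLocalRing : Prop where
  isNoetherianRing : IsNoetherianRing A
  exists_isRegular : ∃ xs : List A,
    RingTheory.Sequence.IsRegular A xs ∧ (xs.length : WithBot ℕ∞) = ringKrullDim A

end LocalAlgebra

section TightClosure

variable {A : Type u} [CommRing A]

/-- The bracket power `I^[q]`, the ideal generated by the `q`-th powers of the elements of `I`. -/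
def bracketPower (I : Ideal A) (q : ℕ) : Ideal A :=
  Ideal.span ((fun a => a ^ q) '' (I : Set A))

variable (A) in
/-- The set `A°` of the elements that lie in no minimal prime of `A`. -/
def compMinimalPrimes : Set A := {c | ∀ P ∈ minimalPrimes A, c ∉ P}

/-- The tight closure `I^*` of an ideal in characteristic `p`: the elements `r` for which there
is `c ∈ A°` with `c r^q ∈ I^[q]` for all large powers `q = p ^ e`. -/
def tightClosure (p : ℕ) (I : Ideal A) : Set A :=
  {r | ∃ c ∈ compMinimalPrimes A, ∃ N : ℕ, ∀ e ≥ N, c * r ^ p ^ e ∈ bracketPower I (p ^ e)}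

end TightClosure

section Purity

/-- A commutative algebra `B` over `A` is pure if `N → B ⊗[A] N`, `n ↦ 1 ⊗ n`, is injective
for every `A`-module `N`. -/
def IsPureAlgebra (A : Type u) (B : Type v) [CommRing A] [CommRing B] [Algebra A B] : Prop :=
  ∀ (N : Type u) [AddCommGroup N] [Module A N],
    Function.Injective (TensorProduct.mk A B N 1)

/-- A ring homomorphism `φ : A → B` is pure if `B`, regarded as an `A`-algebra through `φ`,
is pure. -/
def IsPureHom {A : Type u} {B : Type v} [CommRing A] [CommRing B] (φ : A →+* B) : Prop :=
  @IsPureAlgebra A B _ _ φ.toAlgebra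

/-- For module-finite algebras over noetherian rings, purity is the same as the existence of
an `A`-linear retraction `B → A`. -/
theorem isPureAlgebra_iff_exists_retraction (A : Type u) (B : Type v) [CommRing A] [CommRing B]
    [Algebra A B] [IsNoetherianRing A] [Module.Finite A B] :
    IsPureAlgebra A B ↔ ∃ ψ : B →ₗ[A] A, ψ 1 = 1 := by
  constructor
  · intro h
    obtain ⟨n, f, hf⟩ := Module.Finite.exists_fin' A B
    have hfg : (LinearMap.ker f).FG := IsNoetherian.noetherian _
    obtain ⟨m, r, hr⟩ := Submodule.fg_iff_exists_fin_generating_family.mp hfg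
    obtain ⟨s, hs⟩ := hf 1
    have hr0 : ∀ j, f (r j) = 0 := fun j => by
      have : r j ∈ LinearMap.ker f := hr ▸ Submodule.subset_span ⟨j, rfl⟩
      exact this
    -- `D a = (a(r₁), …, a(r_m), a(s))` for a linear form `a` on `Aⁿ`
    let D : (Fin n → A) →ₗ[A] (Fin m → A) × A :=
      { toFun := fun a => (fun j => ∑ i, r j i * a i, ∑ i, s i * a i)
        map_add' := fun a b => by
          ext <;> simp [mul_add, Finset.sum_add_distrib]
        map_smul' := fun c a => by
          ext <;> simp [Finset.mul_sum, mul_left_comm] }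
    let N := ((Fin m → A) × A) ⧸ LinearMap.range D
    let v : N := Submodule.Quotient.mk (0, 1)
    have key : (1 : B) ⊗ₜ[A] v = 0 := by
      have hf' : ∀ x : Fin n → A, f x = ∑ i, x i • f (Pi.single i 1) := fun x => by
        conv_lhs => rw [pi_eq_sum_univ' x]
        rw [map_sum]
        refine Finset.sum_congr rfl fun i _ => ?_
        rw [map_smul]
      have hD : ∀ i, (Submodule.Quotient.mk (D (Pi.single i 1)) : N) = 0 := fun i =>
        (Submodule.Quotient.mk_eq_zero _).mpr ⟨_, rfl⟩
      have hDi : ∀ i, D (Pi.single i 1) =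
          (∑ j, r j i • ((Pi.single j 1, 0) : (Fin m → A) × A)) + s i • (0, 1) := fun i => by
        ext k
        · simp [D, Pi.single_apply, Prod.fst_sum, Finset.sum_apply]
        · simp [D, Pi.single_apply, Prod.snd_sum]
      let e : Fin m → N := fun j => Submodule.Quotient.mk (Pi.single j 1, 0)
      have hrel : ∀ i, s i • v = - ∑ j, r j i • e j := fun i => by
        have h1 := hD i
        rw [hDi i] at h1
        have h2 : (∑ j, r j i • e j) + s i • v = 0 := by
          rw [← h1]
          change _ = (LinearMap.range D).mkQ _
          rw [map_add, map_sum, map_smul]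
          simp only [map_smul]
          rfl
        exact eq_neg_of_add_eq_zero_right h2
      rw [← hs, hf' s, TensorProduct.sum_tmul]
      simp only [TensorProduct.smul_tmul, hrel, TensorProduct.tmul_neg, TensorProduct.tmul_sum]
      rw [Finset.sum_neg_distrib, Finset.sum_comm, neg_eq_zero]
      refine Finset.sum_eq_zero fun j _ => ?_
      have h3 := hr0 j
      rw [hf'] at h3
      calc ∑ i, f (Pi.single i 1) ⊗ₜ[A] (r j i • e j)
          = (∑ i, r j i • f (Pi.single i 1)) ⊗ₜ[A] e j := by
            rw [TensorProduct.sum_tmul]; simp only [TensorProduct.smul_tmul]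
        _ = 0 := by rw [h3, TensorProduct.zero_tmul]
    have hv : v = 0 := h N (by simpa using key)
    obtain ⟨a, ha⟩ := (Submodule.Quotient.mk_eq_zero _).mp hv
    let g : (Fin n → A) →ₗ[A] A := ∑ i, a i • LinearMap.proj i
    have hg : ∀ x, g x = ∑ i, x i * a i := fun x => by
      simp [g, LinearMap.sum_apply, mul_comm]
    have hker : LinearMap.ker f ≤ LinearMap.ker g := by
      rw [← hr, Submodule.span_le]
      rintro _ ⟨j, rfl⟩
      have := congrFun (congrArg Prod.fst ha) j
      simpa [hg, D] using this
    refine ⟨((LinearMap.ker f).liftQ g hker).comp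
      (f.quotKerEquivOfSurjective hf).symm.toLinearMap, ?_⟩
    have h4 : (f.quotKerEquivOfSurjective hf).symm 1 = Submodule.Quotient.mk s := by
      rw [LinearEquiv.symm_apply_eq, ← hs]; rfl
    have h5 := congrArg Prod.snd ha
    simp only [LinearMap.comp_apply, LinearEquiv.coe_coe, h4]
    simpa [hg, D] using h5
  · rintro ⟨ψ, hψ⟩ N _ _ x y hxy
    have := congrArg (fun t => TensorProduct.lid A N (ψ.rTensor N t)) hxy
    simpa [hψ] using this

/-- A finite homomorphism `φ : A → B` with `A` noetherian is pure if and only if it splits. -/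
theorem isPureHom_iff_exists_splitting {A : Type u} {B : Type v} [CommRing A] [CommRing B]
    [IsNoetherianRing A] (φ : A →+* B) (hφ : φ.Finite) :
    IsPureHom φ ↔ ∃ ψ : B →+ A, (∀ a b, ψ (φ a * b) = a * ψ b) ∧ ψ 1 = 1 := by
  let _ := φ.toAlgebra
  have : Module.Finite A B := hφ
  refine (isPureAlgebra_iff_exists_retraction A B).trans ⟨?_, ?_⟩
  · rintro ⟨ψ, hψ⟩
    exact ⟨ψ.toAddMonoidHom, fun a b => ψ.map_smul a b, hψ⟩
  · rintro ⟨ψ, h1, h2⟩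
    exact ⟨{ toFun := ψ, map_add' := ψ.map_add, map_smul' := fun a b => h1 a b }, h2⟩

end Purity

section Local

variable (p : ℕ) [Fact p.Prime] (A : Type u) [CommRing A]

/-- A local ring of characteristic `p` is `F`-rational if it is Cohen--Macaulay and each of its
parameter ideals is tightly closed. -/
structure IsFRationalLocalRing [IsLocalRing A] : Prop where
  charP : CharP A p
  isCohenMacaulay : IsCohenMacaulayLocalRing A
  tightClosure_eq : ∀ I : Ideal A, IsParameterIdeal A I → tightClosure p I = (I : Set A)

/-- A noetherian local ring of characteristic `p` is `F`-pure if its Frobenius endomorphism is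
pure. -/
structure IsFPureLocalRing : Prop where
  isLocalRing : IsLocalRing A
  isNoetherianRing : IsNoetherianRing A
  charP : CharP A p
  isPureHom_frobenius : IsPureHom (frobenius A p)

variable {A} in
/-- If the Frobenius endomorphism is finite, then `F`-purity means that it splits: there is an
additive map `ψ : A → A` with `ψ (a ^ p * b) = a * ψ b` and `ψ 1 = 1`. -/
theorem isFPureLocalRing_iff_exists_splitting [IsLocalRing A] [IsNoetherianRing A] [CharP A p]
    (hF : (frobenius A p).Finite) :
    IsFPureLocalRing p A ↔
      ∃ ψ : A →+ A, (∀ a b : A, ψ (a ^ p * b) = a * ψ b) ∧ ψ 1 = 1 := by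
  refine Iff.trans ?_ (isPureHom_iff_exists_splitting (frobenius A p) hF)
  exact ⟨fun h => h.isPureHom_frobenius, fun h => ⟨inferInstance, inferInstance, inferInstance, h⟩⟩

end Local

section Global

variable (p : ℕ) [Fact p.Prime] (R : Type u) [CommRing R]

/-- A ring is `F`-rational if its local rings at all prime ideals are. -/
def IsFRational : Prop :=
  ∀ (P : Ideal R) [P.IsPrime], IsFRationalLocalRing p (Localization.AtPrime P)

/-- A ring is `F`-pure if its local rings at all prime ideals are. -/
def IsFPure : Prop :=
  ∀ (P : Ideal R) [P.IsPrime], IsFPureLocalRing p (Localization.AtPrime P)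

/-- The algebra `R → S` has regular fibers: `κ(P) ⊗[R] S` is a regular ring for every prime
ideal `P` of `R`. -/
def HasRegularFibers (S : Type v) [CommRing S] [Algebra R S] : Prop :=
  ∀ (P : Ideal R) [P.IsPrime], IsRegularRing (P.Fiber S)

end Global

end FSing

/-!
Let `A → B` be the local ring of `R ⊗[K] L` at a prime, over the local ring of `R` below it. It is
flat, and distinct comparable primes of `B` have distinct contractions to `A`; hence `A` and `B`
have the same dimension, systems of parameters of `A` are systems of parameters of `B`, and `B` is
Cohen--Macaulay if `A` is.

*`F`-purity.* Since `L` is a Frobenius algebra over `K`, the functor `Hom_R(R ⊗[K] L, -)` is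
tensoring with `R ⊗[K] L`. An element `n` of a `B`-module killed by the maximal ideal can therefore
be mapped to an element `t ⊗ u` of some `B ⊗[A] E`, with `u ≠ 0`, and `t` is a unit because the
closed fiber, being regular and artinian, is reduced (`exists_linearMap_tensorProduct`). Purity of
the Frobenius of `A` shows that the Frobenius base change of `E` does not kill `u`, and by flatness
that of `B ⊗[A] E` does not kill `t ⊗ u` (`IsPureAlgebra.of_faithfullyFlat`).

*`F`-rationality.* Let `F` be the separable closure of `K` in `L`.

The step from `K` to `F` uses that the `p ^ e`-th powers of a basis of `F` over `K` form a basis.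
Comparing coordinates, one sees that ideals generated by systems of parameters of `A` stay tightly
closed in `B` (`mem_map_of_forall_mul_pow_mem_bracketPower`). An arbitrary system of parameters of
`B` is changed into one from `A` by exchanging one element at a time, which works because every
system of parameters of a Cohen--Macaulay local ring is a regular sequence
(`tightClosure_subset_of_forall_map`).

In the step from `F` to `L`, a power of the Frobenius of `B` factors through `A`, so that `z ∈ I^*`
implies `z ^ q ∈ I^[q]` for a parameter ideal `I` of `B`; as `B` is already known to be `F`-pure,
`z ∈ I` follows (`tightClosure_eq_of_pow_mem_range`). This is where `F`-purity is needed to ascend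
`F`-rationality along inseparable extensions.
-/

namespace FSing

open IsLocalRing RingTheory.Sequence

/-! ### Systems of parameters and regular sequences -/

/-- Prime avoidance for finite sets of primes. -/
theorem exists_mem_forall_notMem_of_finite {A : Type*} [CommRing A] {s : Set (Ideal A)}
    (hs : s.Finite) (hp : ∀ P ∈ s, P.IsPrime) {I : Ideal A} (h : ∀ P ∈ s, ¬ I ≤ P) :
    ∃ x ∈ I, ∀ P ∈ s, x ∉ P := by
  by_contra! hcon
  obtain ⟨P, hP, hIP⟩ := (Ideal.subset_union_prime (s := hs.toFinset) (f := id) ⊥ ⊥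
    (fun P hP _ _ => hp P (hs.mem_toFinset.mp hP)) (I := I)).mp fun x hx => by
      obtain ⟨P, hP, hxP⟩ := hcon x hx
      simp only [Set.mem_iUnion]
      exact ⟨P, by simpa using hP, hxP⟩
  exact h P (hs.mem_toFinset.mp hP) hIP

theorem ofList_perm {A : Type*} [CommRing A] {xs ys : List A} (h : xs.Perm ys) :
    Ideal.ofList xs = Ideal.ofList ys :=
  congrArg Ideal.span (Set.ext fun _ => h.mem_iff)

theorem ofList_concat {A : Type*} [CommRing A] (js : List A) (a : A) :
    Ideal.ofList (js ++ [a]) = Ideal.ofList js ⊔ Ideal.span {a} := by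
  rw [Ideal.ofList_append, Ideal.ofList_singleton]

theorem isWeaklyRegular_concat_iff {A : Type*} [CommRing A] {js : List A} {a : A} :
    IsWeaklyRegular A (js ++ [a]) ↔
      IsWeaklyRegular A js ∧ ∀ z, a * z ∈ Ideal.ofList js → z ∈ Ideal.ofList js := by
  rw [isWeaklyRegular_append_iff, isWeaklyRegular_singleton_iff]
  refine and_congr_right fun _ => ?_
  rw [isSMulRegular_quotient_iff_mem_of_smul_mem]
  simp

/-- A regular last element can be exchanged for any `b` modulo which it becomes nilpotent. -/
theorem isWeaklyRegular_concat_of_mem_radical {A : Type*} [CommRing A] {js : List A} {a b : A}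
    (ha : IsWeaklyRegular A (js ++ [a])) (hab : a ∈ (Ideal.ofList js ⊔ Ideal.span {b}).radical) :
    IsWeaklyRegular A (js ++ [b]) := by
  rw [isWeaklyRegular_concat_iff] at ha ⊢
  refine ⟨ha.1, fun z hz => ?_⟩
  obtain ⟨n, hn⟩ := hab
  have h1 : a ^ n * z ∈ Ideal.ofList js := by
    obtain ⟨j, hj, c, hc, hjc⟩ := Submodule.mem_sup.mp hn
    obtain ⟨d, rfl⟩ := Ideal.mem_span_singleton'.mp hc
    rw [← hjc, add_mul, mul_assoc]
    exact add_mem (Ideal.mul_mem_right _ _ hj) (Ideal.mul_mem_left _ _ hz)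
  clear hn
  induction n with
  | zero => simpa using h1
  | succ n ih => exact ih (ha.2 _ (by rwa [← mul_assoc, ← pow_succ']))

section Parameters

variable {A : Type u} [CommRing A] [IsLocalRing A]

theorem IsSystemOfParameters.perm {xs ys : List A} (h : IsSystemOfParameters A xs)
    (hp : xs.Perm ys) : IsSystemOfParameters A ys :=
  ⟨hp.length_eq ▸ h.1, ofList_perm hp ▸ h.2⟩

theorem IsSystemOfParameters.ofList_le {xs : List A} (h : IsSystemOfParameters A xs) :
    Ideal.ofList xs ≤ maximalIdeal A :=
  h.2 ▸ Ideal.le_radical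

theorem IsSystemOfParameters.mem_maximalIdeal {xs : List A} (h : IsSystemOfParameters A xs)
    {x : A} (hx : x ∈ xs) : x ∈ maximalIdeal A :=
  h.ofList_le (Ideal.subset_span hx)

/-- If `J + (y)` is primary to the maximal ideal and `x` lies in no minimal prime of `J` other
than the maximal ideal, then `J + (x)` is primary to the maximal ideal: by Krull's principal ideal
theorem, every non-maximal prime over `J` is minimal over `J`. -/
theorem radical_sup_span_singleton_eq [IsNoetherianRing A] {J : Ideal A} {x y : A}
    (hy : (J ⊔ Ideal.span {y}).radical = maximalIdeal A) (hx : x ∈ maximalIdeal A)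
    (hxJ : ∀ P ∈ J.minimalPrimes, P ≠ maximalIdeal A → x ∉ P) :
    (J ⊔ Ideal.span {x}).radical = maximalIdeal A := by
  have hJm : J ≤ maximalIdeal A := hy ▸ le_sup_left.trans Ideal.le_radical
  apply le_antisymm
  · rw [(maximalIdeal.isMaximal A).isPrime.isRadical.radical_le_iff]
    exact sup_le hJm ((Ideal.span_singleton_le_iff_mem _).mpr hx)
  · rw [Ideal.radical_eq_sInf]
    refine le_sInf ?_
    rintro P ⟨hP, hPp⟩
    by_contra hne
    have hJP : J ≤ P := le_sup_left.trans hP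
    have hPm : P < maximalIdeal A := lt_of_le_of_ne (le_maximalIdeal hPp.ne_top)
      (fun h => hne h.ge)
    have h1 : P ∈ (Ideal.span (J : Set A)).minimalPrimes := by
      refine Ideal.mem_minimalPrimes_span_of_mem_minimalPrimes_span_insert hPm y J ?_ J hJP ?_
      · rw [Ideal.span_insert, sup_comm, Ideal.span_eq]
        refine ⟨⟨inferInstance, hy ▸ Ideal.le_radical⟩, ?_⟩
        rintro Q ⟨hQ, hQJ⟩ -
        rw [← hy]
        exact hQ.radical_le_iff.mpr hQJ
      · exact fun z hz => Ideal.le_radical (Ideal.subset_span (Set.mem_insert_of_mem _ hz))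
    rw [Ideal.span_eq] at h1
    exact hxJ P h1 hPm.ne (hP (Ideal.mem_sup_right (Ideal.mem_span_singleton_self x)))

theorem IsSystemOfParameters.exchange {js : List A} {a b : A}
    (ha : IsSystemOfParameters A (js ++ [a]))
    (hb : (Ideal.ofList js ⊔ Ideal.span {b}).radical = maximalIdeal A) :
    IsSystemOfParameters A (js ++ [b]) :=
  ⟨by simpa using ha.1, by rw [ofList_concat, hb]⟩

variable [IsNoetherianRing A]

/-- Two systems of parameters with a common part are linked by exchanging one element at a time,
through parameters chosen by prime avoidance. -/
theorem isWeaklyRegular_append_of_isSystemOfParameters (ys : List A) :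
    ∀ ws xs : List A, xs.length = ys.length →
      IsSystemOfParameters A (ws ++ xs) → IsSystemOfParameters A (ws ++ ys) →
      IsWeaklyRegular A (ws ++ xs) → IsWeaklyRegular A (ws ++ ys) := by
  induction ys with
  | nil =>
    intro ws xs hlen _ _ h
    rwa [List.length_eq_zero_iff.mp hlen] at h
  | cons y ys ih =>
    intro ws xs hlen hx hy hreg
    obtain _ | ⟨x, xs⟩ := xs
    · simp at hlen
    have hlen' : xs.length = ys.length := by simpa using hlen
    have toEnd (a : A) (l : List A) : (ws ++ a :: l).Perm ((ws ++ l) ++ [a]) :=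
      List.perm_middle.trans (List.perm_append_comm (l₁ := [a]))
    have toMid (a : A) (l : List A) : ((ws ++ l) ++ [a]).Perm ((ws ++ [a]) ++ l) := by
      refine (toEnd a l).symm.trans ?_
      simp
    replace hx := hx.perm (toEnd x xs)
    replace hy := hy.perm (toEnd y ys)
    replace hreg := isWeaklyRegular_of_perm_of_subset_maximalIdeal hreg (toEnd x xs)
      fun r hr => hx.mem_maximalIdeal ((toEnd x xs).mem_iff.mp hr)
    obtain ⟨w, hw, hw'⟩ := exists_mem_forall_notMem_of_finite
      (s := ((Ideal.ofList (ws ++ xs)).minimalPrimes ∪ (Ideal.ofList (ws ++ ys)).minimalPrimes) \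
        {maximalIdeal A}) (I := maximalIdeal A)
      ((Set.Finite.union (Ideal.finite_minimalPrimes_of_isNoetherianRing _ _)
        (Ideal.finite_minimalPrimes_of_isNoetherianRing _ _)).sdiff)
      (fun P hP => hP.1.elim (fun h => h.isPrime) (fun h => h.isPrime))
      (fun P hP hle => hP.2 <| by
        have : P.IsPrime := hP.1.elim (fun h => h.isPrime) (fun h => h.isPrime)
        exact (le_maximalIdeal this.ne_top).antisymm hle)
    have hrx := radical_sup_span_singleton_eq ((ofList_concat _ x).symm ▸ hx.2 :) hw
      fun P hP hne => hw' P ⟨Or.inl hP, hne⟩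
    have hry := radical_sup_span_singleton_eq ((ofList_concat _ y).symm ▸ hy.2 :) hw
      fun P hP hne => hw' P ⟨Or.inr hP, hne⟩
    have hwx := hx.exchange hrx
    have hwy := hy.exchange hry
    have h1 : IsWeaklyRegular A ((ws ++ xs) ++ [w]) :=
      isWeaklyRegular_concat_of_mem_radical hreg (by
        rw [hrx]; exact hx.mem_maximalIdeal (by simp))
    have h2 : IsWeaklyRegular A ((ws ++ [w]) ++ xs) :=
      isWeaklyRegular_of_perm_of_subset_maximalIdeal h1 (toMid w xs)
        fun r hr => hwx.mem_maximalIdeal hr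
    have h3 := ih (ws ++ [w]) xs hlen' (hwx.perm (toMid w xs)) (hwy.perm (toMid w ys)) h2
    have h4 : IsWeaklyRegular A ((ws ++ ys) ++ [w]) :=
      isWeaklyRegular_of_perm_of_subset_maximalIdeal h3 (toMid w ys).symm
        fun r hr => hwy.mem_maximalIdeal ((toMid w ys).mem_iff.mpr hr)
    have h5 : IsWeaklyRegular A ((ws ++ ys) ++ [y]) :=
      isWeaklyRegular_concat_of_mem_radical h4 (by
        rw [← ofList_concat, hy.2]; exact hw)
    exact isWeaklyRegular_of_perm_of_subset_maximalIdeal h5 (toEnd y ys).symm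
        fun r hr => hy.mem_maximalIdeal hr

/-- A regular sequence of length `dim A` is a system of parameters. -/
theorem isSystemOfParameters_of_isRegular {xs : List A} (h : IsRegular A xs)
    (hlen : (xs.length : WithBot ℕ∞) = ringKrullDim A) : IsSystemOfParameters A xs := by
  refine ⟨hlen, le_antisymm ?_ ?_⟩
  · rw [(maximalIdeal.isMaximal A).isPrime.isRadical.radical_le_iff]
    refine le_maximalIdeal fun htop => h.top_ne_smul ?_
    rw [htop, Submodule.top_smul]
  · have hdim := ringKrullDim_add_length_eq_ringKrullDim_of_isRegular xs h
    rw [← hlen] at hdim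
    have h0 : ringKrullDim (A ⧸ Ideal.ofList xs) = 0 := by
      generalize ringKrullDim (A ⧸ Ideal.ofList xs) = d at hdim
      induction d using WithBot.recBotCoe with
      | bot => simp at hdim
      | coe d =>
        have h1 : d + (xs.length : ℕ∞) = xs.length := by exact_mod_cast hdim
        have h2 : d = 0 := by
          have h3 : d + (xs.length : ℕ∞) = 0 + xs.length := by rw [h1, zero_add]
          exact WithTop.add_right_cancel (ENat.natCast_ne_top _) h3
        simp [h2]
    have : Ring.KrullDimLE 0 (A ⧸ Ideal.ofList xs) := by
      rw [Ring.krullDimLE_iff, h0]; simp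
    rw [Ideal.radical_eq_sInf]
    refine le_sInf ?_
    rintro P ⟨hP, hPp⟩
    have hPq : (P.map (Ideal.Quotient.mk (Ideal.ofList xs))).IsPrime :=
      Ideal.isPrime_map_quotientMk_of_isPrime hP
    have hmax := Ring.krullDimLE_zero_iff.mp this _ hPq
    have := Ideal.comap_isMaximal_of_surjective _ Ideal.Quotient.mk_surjective
      (K := P.map (Ideal.Quotient.mk (Ideal.ofList xs)))
    rw [Ideal.comap_map_of_surjective _ Ideal.Quotient.mk_surjective, ← RingHom.ker_eq_comap_bot,
      Ideal.mk_ker, sup_eq_left.mpr hP] at this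
    exact (eq_maximalIdeal this).ge

/-- In a Cohen--Macaulay local ring, every system of parameters is a regular sequence. -/
theorem IsCohenMacaulayLocalRing.isWeaklyRegular (hA : IsCohenMacaulayLocalRing A) {ys : List A}
    (hy : IsSystemOfParameters A ys) : IsWeaklyRegular A ys := by
  obtain ⟨xs, hreg, hlen⟩ := hA.exists_isRegular
  refine isWeaklyRegular_append_of_isSystemOfParameters ys [] xs ?_
    (isSystemOfParameters_of_isRegular hreg hlen) hy hreg.toIsWeaklyRegular
  have := hlen.trans hy.1.symm
  exact_mod_cast this

end Parameters

/-! ### Bracket powers and tight closure -/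

section Bracket

variable {A : Type*} [CommRing A] (p : ℕ) [Fact p.Prime] [CharP A p]

theorem bracketPower_eq_map (I : Ideal A) (e : ℕ) :
    bracketPower I (p ^ e) = I.map (iterateFrobenius A p e) := by
  rw [bracketPower, Ideal.map]
  rfl

theorem bracketPower_ofList (xs : List A) (e : ℕ) :
    bracketPower (Ideal.ofList xs) (p ^ e) = Ideal.ofList (xs.map (· ^ p ^ e)) := by
  rw [bracketPower_eq_map, Ideal.map_ofList]
  rfl

theorem bracketPower_bracketPower (I : Ideal A) (e f : ℕ) :
    bracketPower (bracketPower I (p ^ e)) (p ^ f) = bracketPower I (p ^ (e + f)) := by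
  rw [bracketPower_eq_map, bracketPower_eq_map, bracketPower_eq_map, Ideal.map_map]
  congr 1
  ext x
  simp [iterateFrobenius_def, ← pow_mul, pow_add]

theorem map_bracketPower {B : Type*} [CommRing B] [CharP B p] (f : A →+* B) (I : Ideal A)
    (e : ℕ) : (bracketPower I (p ^ e)).map f = bracketPower (I.map f) (p ^ e) := by
  rw [bracketPower_eq_map, bracketPower_eq_map, Ideal.map_map, Ideal.map_map]
  congr 1
  ext x
  simp [iterateFrobenius_def]

end Bracket

section TightClosure

variable {A : Type*} [CommRing A]

theorem pow_mem_bracketPower {I : Ideal A} {a : A} (ha : a ∈ I) (q : ℕ) :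
    a ^ q ∈ bracketPower I q :=
  Ideal.subset_span ⟨a, ha, rfl⟩

theorem bracketPower_mono {I J : Ideal A} (h : I ≤ J) (q : ℕ) :
    bracketPower I q ≤ bracketPower J q :=
  Ideal.span_mono (Set.image_mono h)

theorem subset_tightClosure (p : ℕ) (I : Ideal A) : (I : Set A) ⊆ tightClosure p I :=
  fun a ha => ⟨1, fun _ hP h1 => hP.isPrime.ne_top ((Ideal.eq_top_iff_one _).mpr h1), 0,
    fun e _ => by simpa using pow_mem_bracketPower ha (p ^ e)⟩

theorem tightClosure_mono (p : ℕ) {I J : Ideal A} (h : I ≤ J) :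
    tightClosure p I ⊆ tightClosure p J := by
  rintro r ⟨c, hc, N, hN⟩
  exact ⟨c, hc, N, fun e he => bracketPower_mono h _ (hN e he)⟩

theorem mul_mem_bracketPower {I J : Ideal A} {w : A} (h : ∀ a ∈ I, w * a ∈ J) (q : ℕ) {z : A}
    (hz : z ∈ bracketPower I q) : w ^ q * z ∈ bracketPower J q := by
  refine Submodule.span_induction ?_ (by simp) ?_ ?_ hz
  · rintro _ ⟨a, ha, rfl⟩
    simpa [← mul_pow] using pow_mem_bracketPower (h a ha) q
  · intro x y _ _ hx hy
    rw [mul_add]; exact add_mem hx hy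
  · intro a x _ hx
    rw [smul_eq_mul, mul_left_comm]; exact Ideal.mul_mem_left _ _ hx

theorem mul_mem_tightClosure (p : ℕ) {I J : Ideal A} {w : A} (h : ∀ a ∈ I, w * a ∈ J) {z : A}
    (hz : z ∈ tightClosure p I) : w * z ∈ tightClosure p J := by
  obtain ⟨c, hc, N, hN⟩ := hz
  refine ⟨c, hc, N, fun e he => ?_⟩
  rw [mul_pow, mul_left_comm]
  exact mul_mem_bracketPower h _ (hN e he)

end TightClosure

section Partial

variable {A : Type u} [CommRing A] [IsLocalRing A]

theorem IsSystemOfParameters.append_pow {xs ys : List A} (h : IsSystemOfParameters A (xs ++ ys))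
    (n : ℕ) : IsSystemOfParameters A (xs ++ ys.map (· ^ (n + 1))) := by
  refine ⟨by simpa using h.1, le_antisymm ?_ ?_⟩
  · rw [(maximalIdeal.isMaximal A).isPrime.isRadical.radical_le_iff, Ideal.ofList, Ideal.span_le]
    intro z hz
    simp only [List.mem_append, List.mem_map, Set.mem_ofPred_eq] at hz
    rcases hz with hz | ⟨y, hy, rfl⟩
    · exact h.mem_maximalIdeal (by simp [hz])
    · exact Ideal.pow_mem_of_mem _ (h.mem_maximalIdeal (by simp [hy])) _ (by simp)
  · rw [← h.2]
    refine Ideal.radical_le_radical_iff.mpr ?_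
    rw [Ideal.ofList, Ideal.span_le]
    intro z hz
    simp only [List.mem_append, Set.mem_ofPred_eq] at hz
    rcases hz with hz | hz
    · exact Ideal.le_radical (Ideal.subset_span (by simp [hz]))
    · refine ⟨n + 1, Ideal.subset_span ?_⟩
      simp only [List.mem_append, Set.mem_ofPred_eq, List.mem_map]
      exact Or.inr ⟨z, hz, rfl⟩

/-- It suffices to test tight closedness on full systems of parameters: an ideal `(x₁, …, x_k)` is
the intersection of the ideals `(x₁, …, x_k, y₁ⁿ, …, y_lⁿ)` by Krull's intersection theorem. -/
theorem tightClosure_eq_of_forall_isSystemOfParameters [IsNoetherianRing A] (p : ℕ)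
    (h : ∀ zs, IsSystemOfParameters A zs →
      tightClosure p (Ideal.ofList zs) ⊆ (Ideal.ofList zs : Set A))
    {I : Ideal A} (hI : IsParameterIdeal A I) : tightClosure p I = (I : Set A) := by
  obtain ⟨xs, ys, hxy, rfl⟩ := hI
  refine (Set.Subset.antisymm · (subset_tightClosure p _)) fun z hz => ?_
  rw [SetLike.mem_coe, ← Ideal.Quotient.eq_zero_iff_mem]
  refine IsHausdorff.haus (I := maximalIdeal A) inferInstance _ fun n => ?_
  have h1 := h _ (hxy.append_pow n) (tightClosure_mono p (by simp) hz)
  rw [SetLike.mem_coe, Ideal.ofList_append] at h1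
  obtain ⟨a, ha, b, hb, rfl⟩ := Submodule.mem_sup.mp h1
  rw [SModEq.zero, map_add, Ideal.Quotient.eq_zero_iff_mem.mpr ha, zero_add]
  have hb' : b ∈ maximalIdeal A ^ n := by
    refine Ideal.span_le.mpr ?_ hb
    intro y hy
    obtain ⟨y, hy', rfl⟩ := List.mem_map.mp hy
    exact Ideal.pow_le_pow_right (Nat.le_succ n)
      (Ideal.pow_mem_pow (hxy.mem_maximalIdeal (List.mem_append_right _ hy')) _)
  have : Ideal.Quotient.mk (Ideal.ofList xs) b = b • (1 : A ⧸ Ideal.ofList xs) := by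
    rw [Algebra.smul_def, mul_one]; rfl
  rw [this]
  exact Submodule.smul_mem_smul hb' trivial

end Partial

/-! ### Flat local extensions satisfying incomparability -/

section Extension

/-- Distinct primes of `B` that are comparable lie over distinct primes of `A`. -/
def HasIncomparability (A : Type*) (B : Type*) [CommRing A] [CommRing B] [Algebra A B] : Prop :=
  ∀ P Q : Ideal B, P.IsPrime → Q.IsPrime → P ≤ Q →
    P.comap (algebraMap A B) = Q.comap (algebraMap A B) → P = Q

variable {A : Type u} {B : Type v} [CommRing A] [CommRing B] [Algebra A B]

/-- An element in no minimal prime of `B` has a multiple that comes from an element of `A` in no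
minimal prime of `A`. -/
theorem HasIncomparability.exists_mem_compMinimalPrimes (h : HasIncomparability A B)
    [IsNoetherianRing A] {c : B} (hc : c ∈ compMinimalPrimes B) :
    ∃ a ∈ compMinimalPrimes A, c ∣ algebraMap A B a := by
  obtain ⟨a, ha, ha'⟩ := exists_mem_forall_notMem_of_finite
    (minimalPrimes.finite_of_isNoetherianRing A) (fun P hP => hP.isPrime)
    (I := (Ideal.span {c}).comap (algebraMap A B)) fun P hP hle => by
      have hPm : P ∈ ((Ideal.span {c}).comap (algebraMap A B)).minimalPrimes :=
        ⟨⟨hP.isPrime, hle⟩, fun Q hQ hQP => hP.2 ⟨hQ.1, bot_le⟩ hQP⟩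
      obtain ⟨P', hP', hcP', hcomap⟩ := Ideal.exists_comap_eq_of_mem_minimalPrimes _ _ hPm
      obtain ⟨Q, hQ, hQP'⟩ := Ideal.exists_minimalPrimes_le (I := ⊥) (J := P') bot_le
      have hQprime := hQ.isPrime
      have h1 : Q.comap (algebraMap A B) ≤ P := hcomap ▸ Ideal.comap_mono hQP'
      have h2 : Q = P' := h Q P' hQprime hP' hQP' <| by
        rw [hcomap]
        exact h1.antisymm (hP.2 ⟨inferInstance, bot_le⟩ h1)
      exact hc Q hQ (h2 ▸ hcP' (Ideal.mem_span_singleton_self c))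
  exact ⟨a, ha', Ideal.mem_span_singleton.mp ha⟩

variable [IsLocalRing A] [IsLocalRing B] [Module.FaithfullyFlat A B]

theorem comap_maximalIdeal_of_faithfullyFlat (A : Type*) (B : Type*) [CommRing A] [CommRing B]
    [Algebra A B] [IsLocalRing A] [IsLocalRing B] [Module.FaithfullyFlat A B] :
    (maximalIdeal B).comap (algebraMap A B) = maximalIdeal A :=
  ((local_hom_TFAE (algebraMap A B)).out 0 4).mp (Module.FaithfullyFlat.isLocalHom A B)

theorem HasIncomparability.eq_maximalIdeal (h : HasIncomparability A B)
    {P : Ideal B} [hP : P.IsPrime] (hle : maximalIdeal A ≤ P.comap (algebraMap A B)) :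
    P = maximalIdeal B := by
  refine h P _ hP inferInstance (le_maximalIdeal hP.ne_top) ?_
  rw [comap_maximalIdeal_of_faithfullyFlat]
  exact (le_maximalIdeal (Ideal.IsPrime.ne_top inferInstance)).antisymm hle

theorem HasIncomparability.radical_map_maximalIdeal (h : HasIncomparability A B) :
    ((maximalIdeal A).map (algebraMap A B)).radical = maximalIdeal B := by
  apply le_antisymm
  · rw [(maximalIdeal.isMaximal B).isPrime.isRadical.radical_le_iff, Ideal.map_le_iff_le_comap,
      comap_maximalIdeal_of_faithfullyFlat]
  · rw [Ideal.radical_eq_sInf]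
    refine le_sInf ?_
    rintro P ⟨hP, hPp⟩
    exact (h.eq_maximalIdeal (Ideal.map_le_iff_le_comap.mp hP)).ge

theorem HasIncomparability.ringKrullDim_eq [IsNoetherianRing A] [IsNoetherianRing B]
    (h : HasIncomparability A B) : ringKrullDim A = ringKrullDim B := by
  have : (maximalIdeal B).LiesOver (maximalIdeal A) :=
    ⟨(comap_maximalIdeal_of_faithfullyFlat A B).symm⟩
  have h1 := Ideal.height_eq_height_add_of_liesOver_of_hasGoingDown (maximalIdeal A)
    (maximalIdeal B)
  have h2 : ((maximalIdeal B).map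
      (Ideal.Quotient.mk ((maximalIdeal A).map (algebraMap A B)))).height = 0 := by
    have hle : (maximalIdeal A).map (algebraMap A B) ≤ maximalIdeal B :=
      h.radical_map_maximalIdeal ▸ Ideal.le_radical
    have : ((maximalIdeal B).map
      (Ideal.Quotient.mk ((maximalIdeal A).map (algebraMap A B)))).IsPrime :=
      Ideal.isPrime_map_quotientMk_of_isPrime hle
    rw [Ideal.height_eq_zero_iff]
    refine ⟨⟨this, bot_le⟩, ?_⟩
    rintro P ⟨hP, -⟩ -
    have h3 : P.comap (Ideal.Quotient.mk ((maximalIdeal A).map (algebraMap A B))) =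
        maximalIdeal B := by
      refine h.eq_maximalIdeal ?_
      rw [← Ideal.map_le_iff_le_comap]
      conv_lhs => rw [← Ideal.mk_ker (I := (maximalIdeal A).map (algebraMap A B))]
      exact Ideal.comap_mono bot_le
    rw [Ideal.map_le_iff_le_comap, h3]
  rw [← maximalIdeal_height_eq_ringKrullDim, ← maximalIdeal_height_eq_ringKrullDim, h1, h2,
    add_zero]

theorem IsSystemOfParameters.map [IsNoetherianRing A] [IsNoetherianRing B]
    (h : HasIncomparability A B) {xs : List A} (hx : IsSystemOfParameters A xs) :
    IsSystemOfParameters B (xs.map (algebraMap A B)) := by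
  refine ⟨by rw [List.length_map, hx.1, h.ringKrullDim_eq], ?_⟩
  rw [← Ideal.map_ofList]
  apply le_antisymm
  · rw [(maximalIdeal.isMaximal B).isPrime.isRadical.radical_le_iff, Ideal.map_le_iff_le_comap,
      comap_maximalIdeal_of_faithfullyFlat]
    exact hx.ofList_le
  · rw [← h.radical_map_maximalIdeal, ← hx.2]
    exact Ideal.radical_le_radical_iff.mpr (Ideal.map_radical_le _)

theorem IsSystemOfParameters.of_map [IsNoetherianRing A] [IsNoetherianRing B]
    (h : HasIncomparability A B) {xs : List A}
    (hx : IsSystemOfParameters B (xs.map (algebraMap A B))) : IsSystemOfParameters A xs := by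
  refine ⟨by rw [h.ringKrullDim_eq, ← hx.1, List.length_map], ?_⟩
  rw [← Ideal.comap_map_eq_self_of_faithfullyFlat (B := B) (Ideal.ofList xs), ← Ideal.comap_radical,
    Ideal.map_ofList, hx.2, comap_maximalIdeal_of_faithfullyFlat]

theorem IsCohenMacaulayLocalRing.of_hasIncomparability [IsNoetherianRing B]
    (h : HasIncomparability A B) (hA : IsCohenMacaulayLocalRing A) :
    IsCohenMacaulayLocalRing B := by
  have := hA.isNoetherianRing
  obtain ⟨xs, hreg, hlen⟩ := hA.exists_isRegular
  exact ⟨inferInstance, xs.map (algebraMap A B), hreg.of_faithfullyFlat,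
    by rw [List.length_map, hlen, h.ringKrullDim_eq]⟩

end Extension

/-! ### Frobenius closed ideals -/

section Pure

/-- Ideals are contracted from pure algebras. -/
theorem IsPureAlgebra.mem_of_algebraMap_mem_map {A : Type u} {B : Type v} [CommRing A] [CommRing B]
    [Algebra A B] (h : IsPureAlgebra A B) {I : Ideal A} {z : A}
    (hz : algebraMap A B z ∈ I.map (algebraMap A B)) : z ∈ I := by
  rw [← Ideal.Quotient.eq_zero_iff_mem] at hz ⊢
  apply h (A ⧸ I)
  apply (Algebra.TensorProduct.quotIdealMapEquivTensorQuot B I).symm.injective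
  simpa [← Algebra.algebraMap_eq_smul_one] using hz

/-- The ring `A`, regarded as an `A`-algebra through the Frobenius endomorphism. -/
def FrobeniusPushforward (_ : ℕ) (A : Type u) : Type u := A

variable (p : ℕ) [Fact p.Prime] (A : Type u) [CommRing A] [CharP A p]

instance : CommRing (FrobeniusPushforward p A) := inferInstanceAs (CommRing A)

instance : Algebra A (FrobeniusPushforward p A) := (frobenius A p).toAlgebra

theorem isPureHom_frobenius_iff :
    IsPureHom (frobenius A p) ↔ IsPureAlgebra A (FrobeniusPushforward p A) := Iff.rfl

variable {A}

/-- If the Frobenius endomorphism is pure, then every ideal is Frobenius closed. -/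
theorem mem_of_pow_mem_bracketPower (h : IsPureHom (frobenius A p)) {I : Ideal A} {z : A} (e : ℕ)
    (hz : z ^ p ^ e ∈ bracketPower I (p ^ e)) : z ∈ I := by
  induction e with
  | zero =>
    rw [bracketPower_eq_map] at hz
    simpa [Ideal.map_id] using hz
  | succ e ih =>
    apply ih
    rw [← bracketPower_bracketPower, pow_succ p e, pow_mul] at hz
    refine ((isPureHom_frobenius_iff p A).mp h).mem_of_algebraMap_mem_map ?_
    rwa [pow_one] at hz

end Pure

/-! ### Tight closure in radicial extensions -/

section Radicial

variable {A : Type u} {B : Type v} [CommRing A] [CommRing B] [Algebra A B]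
  [IsLocalRing A] [IsLocalRing B] [Module.FaithfullyFlat A B] [IsNoetherianRing A]
  [IsNoetherianRing B]

/-- Tight closedness of parameter ideals ascends along extensions `A → B` for which a power of the
Frobenius of `B` factors through `A`, if `B` is `F`-pure: `z ∈ I^*` implies that `z ^ q` lies in
the tight closure of a parameter ideal of `A`, hence in `I^[q]`. -/
theorem tightClosure_eq_of_pow_mem_range (p : ℕ) [Fact p.Prime] [CharP A p] [CharP B p]
    (h : HasIncomparability A B)
    (hA : ∀ I : Ideal A, IsParameterIdeal A I → tightClosure p I = (I : Set A))
    (hB : IsPureHom (frobenius B p)) (e : ℕ)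
    (hpow : ∀ b : B, b ^ p ^ e ∈ (algebraMap A B).range) {I : Ideal B}
    (hI : IsParameterIdeal B I) : tightClosure p I = (I : Set B) := by
  refine Set.Subset.antisymm ?_ (subset_tightClosure p I)
  obtain ⟨xs, ys, hxy, rfl⟩ := hI
  rintro z ⟨c, hc, N, hN⟩
  obtain ⟨a, ha, d, hd⟩ := h.exists_mem_compMinimalPrimes hc
  choose f hf using hpow
  have hmap (l : List B) : (l.map f).map (algebraMap A B) = l.map (· ^ p ^ e) := by
    simp [Function.comp_def, hf]
  have hideal : (Ideal.ofList (xs.map f)).map (algebraMap A B) =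
      bracketPower (Ideal.ofList xs) (p ^ e) := by
    rw [Ideal.map_ofList, hmap, bracketPower_ofList]
  have hsop : IsSystemOfParameters A (xs.map f ++ ys.map f) := by
    refine IsSystemOfParameters.of_map (B := B) h ?_
    rw [← List.map_append, hmap]
    have h1 := IsSystemOfParameters.append_pow (xs := []) (ys := xs ++ ys) hxy (p ^ e - 1)
    rwa [Nat.sub_add_cancel (Nat.one_le_pow _ _ (Fact.out : p.Prime).pos)] at h1
  refine mem_of_pow_mem_bracketPower p hB e ?_
  rw [← hideal, ← hf z]
  refine Ideal.mem_map_of_mem _ ?_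
  rw [← SetLike.mem_coe, ← hA _ ⟨_, _, hsop, rfl⟩]
  refine ⟨a, ha, N, fun k hk => ?_⟩
  rw [← Ideal.comap_map_eq_self_of_faithfullyFlat (B := B) (bracketPower _ (p ^ k)),
    Ideal.mem_comap, map_bracketPower, hideal, bracketPower_bracketPower, map_mul, map_pow, hf,
    ← pow_mul, ← pow_add, hd, mul_comm c, mul_assoc]
  exact Ideal.mul_mem_left _ _ (hN _ (by omega))

end Radicial

/-! ### Tight closure and systems of parameters from a subring -/

section Reduction

variable {A : Type u} {B : Type v} [CommRing A] [CommRing B] [Algebra A B]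
  [IsLocalRing A] [IsLocalRing B] [Module.FaithfullyFlat A B] [IsNoetherianRing A]
  [IsNoetherianRing B]

/-- In a Cohen--Macaulay local ring `B`, it suffices to test tight closedness on the systems of
parameters that come from `A`: the elements of a system of parameters `y` of `B` are replaced one
by one by elements `x = ∑ aᵢ yᵢ` of the ideal `(y)` that come from `A`, where `x` replaces `y₁`
and `a₁` is regular modulo the other parameters. -/
theorem tightClosure_subset_of_forall_map (p : ℕ) (h : HasIncomparability A B)
    (hB : IsCohenMacaulayLocalRing B)
    (hext : ∀ xs : List A, IsSystemOfParameters A xs →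
      tightClosure p (Ideal.ofList (xs.map (algebraMap A B))) ⊆
        (Ideal.ofList (xs.map (algebraMap A B)) : Set B)) (ys : List B) :
    ∀ xs : List A, IsSystemOfParameters B (xs.map (algebraMap A B) ++ ys) →
      tightClosure p (Ideal.ofList (xs.map (algebraMap A B) ++ ys)) ⊆
        (Ideal.ofList (xs.map (algebraMap A B) ++ ys) : Set B) := by
  induction ys with
  | nil =>
    intro xs hx
    rw [List.append_nil] at hx ⊢
    exact hext xs (hx.of_map h)
  | cons y ys ih =>
    intro xs hxy
    set ws := xs.map (algebraMap A B) with hws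
    have hperm : (ws ++ y :: ys).Perm ((ws ++ ys) ++ [y]) :=
      List.perm_middle.trans (List.perm_append_comm (l₁ := [y]))
    replace hxy := hxy.perm hperm
    rw [ofList_perm hperm, ofList_concat]
    set J := Ideal.ofList (ws ++ ys) with hJ
    have hrad : (J ⊔ Ideal.span {y}).radical = maximalIdeal B := by
      rw [hJ, ← ofList_concat]; exact hxy.2
    obtain ⟨x, hxL, hx⟩ := exists_mem_forall_notMem_of_finite
      (s := Ideal.comap (algebraMap A B) '' (J.minimalPrimes \ {maximalIdeal B}))
      (I := (J ⊔ Ideal.span {y}).comap (algebraMap A B))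
      (((Ideal.finite_minimalPrimes_of_isNoetherianRing _ _).sdiff).image _)
      (by
        rintro _ ⟨P, hP, rfl⟩
        have := hP.1.isPrime
        infer_instance)
      (by
        rintro _ ⟨P, hP, rfl⟩ hle
        have hPp := hP.1.isPrime
        refine hP.2 (h.eq_maximalIdeal ?_)
        rw [← comap_maximalIdeal_of_faithfullyFlat A B, ← hrad, Ideal.comap_radical]
        exact (Ideal.IsPrime.isRadical inferInstance).radical_le_iff.mpr hle)
    have hradx := radical_sup_span_singleton_eq hrad (x := algebraMap A B x)
      (hrad ▸ Ideal.le_radical hxL)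
      fun P hP hne hxP => hx _ ⟨P, ⟨hP, hne⟩, rfl⟩ hxP
    have hsop := hxy.exchange hradx
    have hperm' : ((xs ++ [x]).map (algebraMap A B) ++ ys).Perm
        ((ws ++ ys) ++ [algebraMap A B x]) := by
      have : (xs ++ [x]).map (algebraMap A B) ++ ys = ws ++ algebraMap A B x :: ys := by
        simp [hws]
      rw [this]
      exact List.perm_middle.trans (List.perm_append_comm (l₁ := [algebraMap A B x]))
    have hclosed := ih (xs ++ [x]) (hsop.perm hperm'.symm)
    rw [ofList_perm hperm', ofList_concat, ← hJ] at hclosed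
    have hregx := (isWeaklyRegular_concat_iff.mp (hB.isWeaklyRegular hsop)).2
    obtain ⟨j, hj, ay, hay, hxj⟩ := Submodule.mem_sup.mp hxL
    obtain ⟨a, rfl⟩ := Ideal.mem_span_singleton'.mp hay
    have hreg : ∀ v, a * v ∈ J → v ∈ J := fun v hv => hregx v <| by
      rw [← hxj, add_mul, mul_right_comm]
      exact add_mem (Ideal.mul_mem_right _ _ hj) (Ideal.mul_mem_right _ _ hv)
    intro z hz
    have haz : a * z ∈ J ⊔ Ideal.span {algebraMap A B x} := by
      refine hclosed (mul_mem_tightClosure p (fun l hl => ?_) hz)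
      obtain ⟨j', hj', b, hb, rfl⟩ := Submodule.mem_sup.mp hl
      obtain ⟨b, rfl⟩ := Ideal.mem_span_singleton'.mp hb
      have : a * (j' + b * y) = (a * j' - b * j) + b * algebraMap A B x := by
        rw [← hxj]; ring
      rw [this]
      exact Submodule.add_mem_sup
        (sub_mem (Ideal.mul_mem_left _ _ hj') (Ideal.mul_mem_left _ _ hj))
        (Ideal.mul_mem_left _ _ (Ideal.mem_span_singleton_self _))
    obtain ⟨j₁, hj₁, d, hd, hsum⟩ := Submodule.mem_sup.mp haz
    obtain ⟨d, rfl⟩ := Ideal.mem_span_singleton'.mp hd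
    have hzd : z - d * y ∈ J := hreg _ <| by
      have : a * (z - d * y) = j₁ + d * j := by
        rw [mul_sub, ← hsum, ← hxj]; ring
      rw [this]
      exact add_mem hj₁ (Ideal.mul_mem_left _ _ hj)
    rw [SetLike.mem_coe, ← sub_add_cancel z (d * y)]
    exact Submodule.add_mem_sup hzd (Ideal.mul_mem_left _ _ (Ideal.mem_span_singleton_self _))

end Reduction

/-! ### Tight closure in extensions with Frobenius-stable bases -/

section Separable

theorem mem_map_algebraMap_iff_forall_repr_mem {A T ι : Type*} [CommRing A] [CommRing T]
    [Algebra A T] [Fintype ι] (b : Module.Basis ι A T) (I : Ideal A) (t : T) :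
    t ∈ I.map (algebraMap A T) ↔ ∀ i, b.repr t i ∈ I := by
  constructor
  · intro ht i
    refine Submodule.span_induction (p := fun t _ => ∀ s, b.repr (s * t) i ∈ I) ?_ ?_ ?_ ?_ ht 1
      |> (by simpa using ·)
    · rintro _ ⟨a, ha, rfl⟩ s
      rw [mul_comm, ← Algebra.smul_def, map_smul, Finsupp.smul_apply, smul_eq_mul]
      exact Ideal.mul_mem_right _ _ ha
    · simp
    · intro x y _ _ hx hy s
      rw [mul_add, map_add]
      exact add_mem (hx s) (hy s)
    · intro r x _ hx s
      rw [smul_eq_mul, ← mul_assoc]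
      exact hx _
  · intro h
    rw [← b.sum_repr t]
    refine sum_mem fun i _ => ?_
    rw [Algebra.smul_def]
    exact Ideal.mul_mem_right _ _ (Ideal.mem_map_of_mem _ (h i))

/-- A finitely generated ideal that becomes contained in `I` after localization is contained in `I`
up to a single denominator. -/
theorem exists_forall_mul_mem_of_fg {T : Type*} [CommRing T] (Q : Ideal T) [Q.IsPrime]
    {I N : Ideal T} (hN : N.FG) (h : ∀ x ∈ N, ∃ s ∉ Q, s * x ∈ I) :
    ∃ s ∉ Q, ∀ x ∈ N, s * x ∈ I := by
  induction N, hN using Submodule.fg_induction with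
  | singleton x =>
    obtain ⟨s, hs, hsx⟩ := h x (Submodule.mem_span_singleton_self x)
    refine ⟨s, hs, fun y hy => ?_⟩
    obtain ⟨a, rfl⟩ := Submodule.mem_span_singleton.mp hy
    rw [smul_eq_mul, mul_left_comm]
    exact Ideal.mul_mem_left _ _ hsx
  | sup M₁ M₂ _ _ h1 h2 =>
    obtain ⟨s, hs, hs'⟩ := h1 fun x hx => h x (Submodule.mem_sup_left hx)
    obtain ⟨t, ht, ht'⟩ := h2 fun x hx => h x (Submodule.mem_sup_right hx)
    refine ⟨s * t, fun hst => (Ideal.IsPrime.mem_or_mem ‹_› hst).elim hs ht, fun x hx => ?_⟩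
    obtain ⟨y, hy, z, hz, rfl⟩ := Submodule.mem_sup.mp hx
    rw [mul_add]
    refine add_mem ?_ ?_
    · rw [mul_right_comm]; exact Ideal.mul_mem_right _ _ (hs' y hy)
    · rw [mul_assoc]; exact Ideal.mul_mem_left _ _ (ht' z hz)

/-- Let `T` be a free `A`-algebra with a basis whose `p ^ e`-th powers form bases for all `e`, and
let `B` be the localization of `T` at a maximal ideal `Q`. If `I` is a tightly closed ideal of `A`
such that `I B` is primary to the maximal ideal, then `I B` is tightly closed, as far as
multipliers from `A` are concerned. An element `g ∉ Q` with `g Q ^ n ⊆ I T` clears the other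
components of `I T`, so that the coordinates of an element of `T` may be compared. -/
theorem mem_map_of_forall_mul_pow_mem_bracketPower {A T B ι : Type*} [CommRing A] [CommRing T]
    [CommRing B] [Algebra A T] [Algebra T B] [Algebra A B] [IsScalarTower A T B]
    [IsNoetherianRing T] [Fintype ι] [IsLocalRing B]
    (p : ℕ) [Fact p.Prime] [CharP A p] [CharP T p] [CharP B p] (b : Module.Basis ι A T)
    (hb : ∀ e : ℕ, ∃ b' : Module.Basis ι A T, ∀ i, b' i = b i ^ p ^ e)
    (Q : Ideal T) [Q.IsMaximal] [IsLocalization.AtPrime B Q] {I : Ideal A}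
    (hI : tightClosure p I = (I : Set A)) (n : ℕ)
    (hn : maximalIdeal B ^ n ≤ I.map (algebraMap A B)) {c : A} (hc : c ∈ compMinimalPrimes A)
    {z : B} (N : ℕ) (hz : ∀ e ≥ N, algebraMap A B c * z ^ p ^ e ∈
      bracketPower (I.map (algebraMap A B)) (p ^ e)) : z ∈ I.map (algebraMap A B) := by
  have hmapmap (J : Ideal A) :
      J.map (algebraMap A B) = (J.map (algebraMap A T)).map (algebraMap T B) := by
    rw [Ideal.map_map, IsScalarTower.algebraMap_eq A T B]
  -- membership in an extended ideal of `B` in terms of `T`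
  have hmem (J : Ideal T) (t : T) (ht : algebraMap T B t ∈ J.map (algebraMap T B)) :
      ∃ s ∉ Q, s * t ∈ J := by
    rw [IsLocalization.algebraMap_mem_map_algebraMap_iff Q.primeCompl] at ht
    exact ht
  obtain ⟨g, hg, hgQ⟩ := exists_forall_mul_mem_of_fg Q (I := I.map (algebraMap A T))
    (IsNoetherian.noetherian (Q ^ n)) fun x hx => hmem _ x <| by
      rw [← hmapmap]
      refine hn ?_
      rw [← IsLocalization.AtPrime.map_eq_maximalIdeal Q B, ← Ideal.map_pow]
      exact Ideal.mem_map_of_mem _ hx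
  obtain ⟨⟨w, s⟩, hws⟩ := IsLocalization.surj Q.primeCompl z
  simp only at hws
  have hkey : ∀ e ≥ N, algebraMap A T c * (g * w) ^ p ^ e ∈
      (bracketPower I (p ^ e)).map (algebraMap A T) := by
    intro e he
    set J := (bracketPower I (p ^ e)).map (algebraMap A T) with hJ
    set t := algebraMap A T c * w ^ p ^ e with ht
    obtain ⟨s', hs', hst⟩ := hmem J t <| by
      rw [hJ, ← hmapmap, map_bracketPower, ht, map_mul, map_pow, ← hws, mul_pow,
        ← IsScalarTower.algebraMap_apply, ← mul_assoc]
      exact Ideal.mul_mem_right _ _ (hz e he)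
    obtain ⟨a, h, hh, hah⟩ := (inferInstance : Q.IsMaximal).exists_inv hs'
    -- `1 - h ^ m` is a multiple of `1 - h = a * s'`
    have h1 : (1 - h ^ (n * p ^ e)) * t ∈ J := by
      obtain ⟨d, hd⟩ := sub_dvd_pow_sub_pow 1 h (n * p ^ e)
      rw [one_pow] at hd
      have h2 : 1 - h = a * s' := by rw [← hah]; ring
      rw [hd, h2]
      have : a * s' * d * t = a * d * (s' * t) := by ring
      rw [this]
      exact Ideal.mul_mem_left _ _ hst
    have h3 : (g * h ^ n) ^ p ^ e ∈ J := by
      rw [hJ, map_bracketPower]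
      exact pow_mem_bracketPower (hgQ _ (Ideal.pow_mem_pow hh n)) _
    have : algebraMap A T c * (g * w) ^ p ^ e =
        g ^ p ^ e * ((1 - h ^ (n * p ^ e)) * t) + (g * h ^ n) ^ p ^ e * t := by
      rw [ht, pow_mul]; ring
    rw [this]
    exact add_mem (Ideal.mul_mem_left _ _ h1) (Ideal.mul_mem_right _ _ h3)
  have hgw : g * w ∈ I.map (algebraMap A T) := by
    rw [mem_map_algebraMap_iff_forall_repr_mem b]
    intro i
    rw [← SetLike.mem_coe, ← hI]
    refine ⟨c, hc, N, fun e he => ?_⟩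
    obtain ⟨b', hb'⟩ := hb e
    have h1 := (mem_map_algebraMap_iff_forall_repr_mem b' _ _).mp (hkey e he) i
    have h2 : algebraMap A T c * (g * w) ^ p ^ e =
        ∑ j, (c * b.repr (g * w) j ^ p ^ e) • b' j := by
      conv_lhs => rw [← b.sum_repr (g * w), sum_pow_char_pow, Finset.mul_sum]
      refine Finset.sum_congr rfl fun j _ => ?_
      rw [hb', smul_pow, ← Algebra.smul_def, smul_smul]
    rwa [h2, b'.repr_sum_self] at h1
  have hgB : IsUnit (algebraMap T B g) := IsLocalization.map_units B (⟨g, hg⟩ : Q.primeCompl)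
  have hsB : IsUnit (algebraMap T B s) := IsLocalization.map_units B s
  have h1 : algebraMap T B (g * w) ∈ I.map (algebraMap A B) := by
    rw [hmapmap]; exact Ideal.mem_map_of_mem _ hgw
  rw [map_mul, ← hws, Ideal.unit_mul_mem_iff_mem _ hgB, mul_comm,
    Ideal.unit_mul_mem_iff_mem _ hsB] at h1
  exact h1

end Separable

/-! ### Ascent of purity -/

section PureAscent

/-- Purity can be tested on modules in any universe, since it only concerns finitely generated
modules. -/
theorem IsPureAlgebra.eq_zero_of_one_tmul_eq_zero {A : Type u} {C : Type v} [CommRing A]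
    [CommRing C] [Algebra A C] (h : IsPureAlgebra A C) {N : Type w} [AddCommGroup N] [Module A N]
    {n : N} (hn : (1 : C) ⊗ₜ[A] n = 0) : n = 0 := by
  have hn' : (Submodule.span A {n}).subtype.rTensor C
      ((⟨n, Submodule.mem_span_singleton_self n⟩ : Submodule.span A {n}) ⊗ₜ[A] (1 : C)) = 0 := by
    rw [LinearMap.rTensor_tmul, Submodule.subtype_apply]
    apply (TensorProduct.comm A N C).injective
    simpa using hn
  obtain ⟨Q, hQ, hfg, h0⟩ := TensorProduct.eq_zero_of_fg_of_subtype_eq_zero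
    (Submodule.fg_span_singleton n) hn'
  have : Module.Finite A Q := Module.Finite.iff_fg.mpr hfg
  have : Small.{u} Q := Module.Finite.small.{u} A Q
  set q : Q := ⟨n, hQ (Submodule.mem_span_singleton_self n)⟩ with hq
  have h1 : (1 : C) ⊗ₜ[A] q = 0 := by
    apply (TensorProduct.comm A C Q).injective
    simpa [hq, Submodule.inclusion_apply] using h0
  have h2 : (Shrink.linearEquiv A Q).symm q = 0 := by
    apply h
    have := congrArg ((Shrink.linearEquiv A Q).symm.toLinearMap.lTensor C) h1
    simpa using this
  have h3 : q = 0 := (Shrink.linearEquiv A Q).symm.map_eq_zero_iff.mp h2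
  exact congrArg Subtype.val h3

/-- Let `A → B` be a local extension such that every nonzero element `n` of a `B`-module `N` that is
killed by the maximal ideal is mapped by some `B`-linear map `N → B ⊗[A] E` to `t ⊗ u` with
`t` a unit and `u ≠ 0`. Then purity of `A → C` passes to `B → D`, if `D` is
faithfully flat over `C`. -/
theorem IsPureAlgebra.of_faithfullyFlat {A : Type u} {B : Type v} {C D : Type*} [CommRing A]
    [CommRing B] [CommRing C] [CommRing D] [IsLocalRing B] [Algebra A B] [Algebra A C]
    [Algebra B D] [Algebra C D] [Algebra A D] [IsScalarTower A B D] [IsScalarTower A C D]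
    [Module.FaithfullyFlat C D] (hA : IsPureAlgebra A C)
    (hB : ∀ (N : Type v) [AddCommGroup N] [Module B N] (n : N), n ≠ 0 →
      (∀ b ∈ maximalIdeal B, b • n = 0) →
      ∃ (E : Type v) (_ : AddCommGroup E) (_ : Module A E) (Φ : N →ₗ[B] B ⊗[A] E) (t : B) (u : E),
        IsUnit t ∧ u ≠ 0 ∧ Φ n = t ⊗ₜ u) :
    IsPureAlgebra B D := by
  intro N _ _
  rw [injective_iff_map_eq_zero]
  intro n hn
  by_contra hn0
  set W : Submodule B N := maximalIdeal B • Submodule.span B {n} with hW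
  have hnW : n ∉ W := by
    intro hmem
    have h1 : Submodule.span B {n} ≤ W := (Submodule.span_singleton_le_iff_mem _ _).mpr hmem
    have h2 := Submodule.eq_bot_of_le_smul_of_le_jacobson_bot (maximalIdeal B)
      (Submodule.span B {n}) (Submodule.fg_span_singleton n) h1 (maximalIdeal_le_jacobson _)
    exact hn0 (Submodule.span_singleton_eq_bot.mp h2)
  obtain ⟨E, _, _, Φ, t, u, ht, hu, hΦ⟩ := hB (N ⧸ W) (W.mkQ n)
    (by simpa [Submodule.Quotient.mk_eq_zero] using hnW) fun b hb => by
      rw [← map_smul, Submodule.mkQ_apply, Submodule.Quotient.mk_eq_zero]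
      exact Submodule.smul_mem_smul hb (Submodule.mem_span_singleton_self n)
  apply hu
  refine hA.eq_zero_of_one_tmul_eq_zero (C := C) ?_
  apply Module.FaithfullyFlat.tensorProduct_mk_injective (A := C) (B := D) (C ⊗[A] E)
  rw [map_zero]
  apply (TensorProduct.AlgebraTensorModule.cancelBaseChange A C C D E).injective
  rw [TensorProduct.mk_apply, TensorProduct.AlgebraTensorModule.cancelBaseChange_tmul, one_smul,
    map_zero]
  have h1 : (t • (1 : D)) ⊗ₜ[A] u = 0 := by
    have h3 : (t • (1 : D)) ⊗ₜ[A] u =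
        TensorProduct.AlgebraTensorModule.cancelBaseChange A B B D E (1 ⊗ₜ (t ⊗ₜ u)) := rfl
    rw [h3, ← hΦ]
    have h2 := congrArg ((Φ ∘ₗ W.mkQ).lTensor D) hn
    rw [TensorProduct.mk_apply, LinearMap.lTensor_tmul, map_zero, LinearMap.comp_apply] at h2
    rw [h2, map_zero]
  obtain ⟨s, hs⟩ := ht.exists_left_inv
  have h2 := congrArg (fun x => (s • (1 : D)) • x) h1
  simpa [TensorProduct.smul_tmul', smul_smul, hs, smul_mul_smul_comm] using h2

end PureAscent

section FrobeniusExtension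

/-- Let `S` be a ring extension of `R` with an `R`-linear form `τ` and a pair of dual bases
`e`, `f` with respect to `(x, y) ↦ τ (x y)`, let `P` be a prime of `R` such that `S / P S` is
reduced, let `A = R_P`, and let `B` be a localization of `S` at a prime over `P`. A nonzero element
`n` of a `B`-module `N` that is killed by the maximal ideal is mapped to some `t ⊗ u` with `t` a
unit and `u ≠ 0` by a `B`-linear map `N → B ⊗[A] E`.

Here `E` is the quotient of `N` by a hyperplane of the `κ(A)`-vector space `B n`, and the map is
the one induced from `N → E` by the identification of `Hom_R(S, E)` with `S ⊗[R] E`. -/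
theorem exists_linearMap_tensorProduct {R S A ι : Type*} {B : Type v} [CommRing R] [CommRing S]
    [CommRing A] [CommRing B] [Algebra R S] [Algebra R A] [Algebra S B] [Algebra A B] [Algebra R B]
    [IsScalarTower R A B] [IsScalarTower R S B] [Fintype ι] (τ : S →ₗ[R] R) (e f : ι → S)
    (he : ∀ x, x = ∑ i, τ (x * f i) • e i) (hf : ∀ x, x = ∑ i, τ (e i * x) • f i)
    (P : Ideal R) [P.IsPrime] (Q : Ideal S) [Q.IsPrime] [IsLocalization.AtPrime A P]
    [IsLocalization.AtPrime B Q] [IsLocalRing A] [IsLocalRing B] [IsLocalHom (algebraMap A B)]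
    (hred : ∀ t : S, t * t ∈ P.map (algebraMap R S) → t ∈ P.map (algebraMap R S))
    (N : Type v) [AddCommGroup N] [Module B N] (n : N) (hn : n ≠ 0)
    (hmn : ∀ b ∈ maximalIdeal B, b • n = 0) :
    ∃ (E : Type v) (_ : AddCommGroup E) (_ : Module A E) (Φ : N →ₗ[B] B ⊗[A] E) (t : B) (u : E),
      IsUnit t ∧ u ≠ 0 ∧ Φ n = t ⊗ₜ u := by
  let _ : Module A N := Module.compHom N (algebraMap A B)
  have : IsScalarTower A B N := IsScalarTower.of_compHom A B N
  let _ : Module S N := Module.compHom N (algebraMap S B)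
  have : IsScalarTower S B N := IsScalarTower.of_compHom S B N
  let _ : Module R N := Module.compHom N (algebraMap R B)
  have : IsScalarTower R B N := IsScalarTower.of_compHom R B N
  have : IsScalarTower R A N := ⟨fun r a x => by
    rw [← algebraMap_smul B r (a • x), ← algebraMap_smul B a x, ← algebraMap_smul B (r • a) x,
      smul_smul, Algebra.smul_def, map_mul, ← IsScalarTower.algebraMap_apply]⟩
  have : IsScalarTower R S N := ⟨fun r a x => by
    rw [← algebraMap_smul B r (a • x), ← algebraMap_smul B a x, ← algebraMap_smul B (r • a) x,
      smul_smul, Algebra.smul_def, map_mul, ← IsScalarTower.algebraMap_apply]⟩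
  obtain ⟨ψ, hψ⟩ := LinearMap.exists_leftInverse_of_injective
    (Algebra.linearMap (ResidueField A) (ResidueField B))
    (LinearMap.ker_eq_bot.mpr (algebraMap (ResidueField A) (ResidueField B)).injective)
  have hψ1 : ψ 1 = 1 := by simpa using LinearMap.congr_fun hψ 1
  let χ : B →ₗ[A] ResidueField A :=
    ψ.restrictScalars A ∘ₗ (IsScalarTower.toAlgHom A B (ResidueField B)).toLinearMap
  have hχ1 : χ 1 = 1 := by simp [χ, hψ1]
  let H : Submodule A N :=
    (LinearMap.ker χ).map ((LinearMap.toSpanSingleton B N n).restrictScalars A)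
  let φ : N →ₗ[A] N ⧸ H := H.mkQ
  set u : N ⧸ H := φ n with hu
  have hnH : n ∉ H := by
    rintro ⟨b, hb, hbn⟩
    have hbn' : (1 - b) • n = 0 := by
      rw [sub_smul, one_smul, sub_eq_zero]
      exact hbn.symm
    have h1 : 1 - b ∈ maximalIdeal B := by
      by_contra hu
      have := (notMem_maximalIdeal.mp hu).smul_eq_zero.mp hbn'
      exact hn this
    have h2 : χ (1 - b) = 0 := by
      have : algebraMap B (ResidueField B) (1 - b) = 0 := (residue_eq_zero_iff _).mpr h1
      simp only [χ, LinearMap.comp_apply, AlgHom.toLinearMap_apply, IsScalarTower.coe_toAlgHom',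
        this, map_zero]
    have h3 : χ b = 0 := hb
    rw [map_sub, hχ1, h3, sub_zero] at h2
    exact one_ne_zero h2
  have hu0 : u ≠ 0 := by
    rw [hu]
    simpa [φ, Submodule.Quotient.mk_eq_zero] using hnH
  -- modulo `H`, every element of `B n` is a multiple of `n` by an element of `A`
  have hφ (b : B) : ∃ a : A, φ (b • n) = a • u := by
    obtain ⟨a, ha⟩ := residue_surjective (χ b)
    refine ⟨a, ?_⟩
    rw [hu, ← map_smul, ← sub_eq_zero, ← map_sub]
    simp only [φ, Submodule.mkQ_apply, Submodule.Quotient.mk_eq_zero]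
    refine ⟨b - a • 1, ?_, ?_⟩
    · change χ (b - a • 1) = 0
      rw [map_sub, map_smul, hχ1, ← ha, sub_eq_zero, Algebra.smul_def, mul_one]
      rfl
    · simp [sub_smul]
  have hmu (a : A) (ha : a ∈ maximalIdeal A) : a • u = 0 := by
    have h1 : algebraMap A B a ∈ maximalIdeal B :=
      map_nonunit (algebraMap A B) a ha
    rw [hu, ← map_smul, ← algebraMap_smul B a n, hmn _ h1, map_zero]
  let Φ₀ : N → B ⊗[A] (N ⧸ H) := fun x => ∑ i, algebraMap S B (f i) ⊗ₜ φ (e i • x)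
  have hΦ₀add (x y : N) : Φ₀ (x + y) = Φ₀ x + Φ₀ y := by
    simp [Φ₀, TensorProduct.tmul_add, Finset.sum_add_distrib]
  have hφR (r : R) (x : N) : φ (r • x) = algebraMap R A r • φ x := by
    rw [← map_smul, algebraMap_smul]
  have hΦ₀S (s : S) (x : N) : Φ₀ (s • x) = algebraMap S B s • Φ₀ x := by
    have h1 (i : ι) : φ (e i • s • x) =
        ∑ j, algebraMap R A (τ (e i * s * f j)) • φ (e j • x) := by
      rw [smul_smul]
      conv_lhs => rw [he (e i * s), Finset.sum_smul, map_sum]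
      refine Finset.sum_congr rfl fun j _ => ?_
      rw [smul_assoc, hφR]
    have h2 (j : ι) : algebraMap S B s * algebraMap S B (f j) =
        ∑ i, algebraMap R A (τ (e i * s * f j)) • algebraMap S B (f i) := by
      rw [← map_mul]
      conv_lhs => rw [hf (s * f j), map_sum]
      refine Finset.sum_congr rfl fun i _ => ?_
      rw [Algebra.smul_def, map_mul, ← IsScalarTower.algebraMap_apply, Algebra.smul_def,
        ← IsScalarTower.algebraMap_apply, mul_assoc]
    simp only [Φ₀, h1, Finset.smul_sum, TensorProduct.smul_tmul', smul_eq_mul, h2,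
      TensorProduct.tmul_sum, TensorProduct.sum_tmul]
    rw [Finset.sum_comm]
    simp only [TensorProduct.tmul_smul, TensorProduct.smul_tmul']
  let Φ : N →ₗ[B] B ⊗[A] (N ⧸ H) :=
    { toFun := Φ₀
      map_add' := hΦ₀add
      map_smul' := fun b x => by
        obtain ⟨⟨s, s'⟩, hs⟩ := IsLocalization.surj Q.primeCompl b
        simp only at hs
        have hunit : IsUnit (algebraMap S B s') := IsLocalization.map_units B s'
        rw [RingHom.id_apply, ← hunit.smul_left_cancel, ← hΦ₀S, smul_smul,
          mul_comm (algebraMap S B s'), hs, ← hΦ₀S, ← algebraMap_smul B (s' : S) (b • x), smul_smul,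
          mul_comm _ b, hs, algebraMap_smul] }
  choose α hα using fun i => hφ (algebraMap S B (e i))
  simp only [algebraMap_smul] at hα
  have hΦn : Φ n = (∑ i, α i • algebraMap S B (f i)) ⊗ₜ u := by
    change Φ₀ n = _
    simp only [Φ₀, hα, TensorProduct.sum_tmul, TensorProduct.tmul_smul, TensorProduct.smul_tmul']
  refine ⟨N ⧸ H, inferInstance, inferInstance, Φ, _, u, ?_, hu0, hΦn⟩
  -- clear denominators
  obtain ⟨s₀, hs₀⟩ := IsLocalization.exist_integer_multiples_of_finite P.primeCompl α
  choose r hr using hs₀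
  have hs₀A : IsUnit (algebraMap R A s₀) := IsLocalization.map_units A s₀
  set t : S := ∑ i, r i • f i with ht
  have htB : algebraMap S B t = algebraMap A B (algebraMap R A s₀) *
      ∑ i, α i • algebraMap S B (f i) := by
    rw [ht, map_sum, Finset.mul_sum]
    refine Finset.sum_congr rfl fun i _ => ?_
    rw [Algebra.smul_def, map_mul, ← IsScalarTower.algebraMap_apply,
      IsScalarTower.algebraMap_apply R A B, hr, Algebra.smul_def, Algebra.smul_def, map_mul,
      mul_assoc]
  -- `τ (h t)` computes `φ (h n)` up to the unit `s₀`
  have hτ (h : S) : algebraMap R A (τ (h * t)) • u = algebraMap R A s₀ • φ (h • n) := by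
    conv_rhs => rw [he h]
    rw [Finset.sum_smul, map_sum, Finset.smul_sum, ht, Finset.mul_sum, map_sum, map_sum,
      Finset.sum_smul]
    refine Finset.sum_congr rfl fun i _ => ?_
    rw [mul_smul_comm, map_smul, smul_eq_mul, smul_assoc, hφR, hα, smul_smul, smul_smul, map_mul,
      hr, Algebra.smul_def]
    ring_nf
  have hP {x : R} (hx : algebraMap R A x • u = 0) : x ∈ P := by
    by_contra hxP
    have : IsUnit (algebraMap R A x) := IsLocalization.map_units A (⟨x, hxP⟩ : P.primeCompl)
    exact hu0 (this.smul_eq_zero.mp hx)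
  have hPτ {x : S} (hx : x ∈ P.map (algebraMap R S)) : τ x ∈ P := by
    have hx' : x ∈ P • (⊤ : Submodule R S) := by
      rw [Ideal.smul_top_eq_map]
      exact hx
    refine Submodule.smul_induction_on hx' (fun a ha y _ => ?_) fun y z hy hz => ?_
    · rw [map_smul]
      exact Ideal.mul_mem_right _ _ ha
    · rw [map_add]
      exact add_mem hy hz
  have htQ : t ∉ Q := by
    intro htQ
    have htn : t • n = 0 := by
      rw [← algebraMap_smul B t n]
      refine hmn _ ?_
      rw [← IsLocalization.AtPrime.map_eq_maximalIdeal Q B]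
      exact Ideal.mem_map_of_mem _ htQ
    have htt : t * t ∈ P.map (algebraMap R S) := by
      rw [hf (t * t)]
      refine sum_mem fun i _ => ?_
      rw [Algebra.smul_def]
      refine Ideal.mul_mem_right _ _ (Ideal.mem_map_of_mem _ (hP ?_))
      rw [← mul_assoc, hτ, mul_smul, htn, smul_zero, map_zero, smul_zero]
    have h1 : τ (1 * t) ∈ P := by
      rw [one_mul]
      exact hPτ (hred t htt)
    have h2 := hτ 1
    rw [one_smul, hmu] at h2
    · exact hu0 (hs₀A.smul_eq_zero.mp h2.symm)
    · rw [← IsLocalization.AtPrime.map_eq_maximalIdeal P A]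
      exact Ideal.mem_map_of_mem _ h1
  have : IsUnit (algebraMap S B t) := IsLocalization.map_units B (⟨t, htQ⟩ : Q.primeCompl)
  rw [htB] at this
  exact isUnit_of_mul_isUnit_right this

end FrobeniusExtension

/-! ### Fibers and localizations -/

section Fibers

/-- An artinian regular ring is reduced: its local rings have dimension zero, so that their maximal
ideals are generated by the empty set. -/
theorem isReduced_of_isRegularRing_of_isArtinianRing (F : Type*) [CommRing F] [IsArtinianRing F]
    [IsRegularRing F] : IsReduced F := by
  refine isReduced_ofLocalizationMaximal F fun J hJ => ?_
  have hreg : IsRegularLocalRing (Localization.AtPrime J) :=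
    IsRegularRing.isRegularLocalRing_localization J
  have h0 : ringKrullDim (Localization.AtPrime J) = 0 := by
    rw [IsLocalization.AtPrime.ringKrullDim_eq_height J, Ideal.height_eq_zero_iff.mpr]
    · rfl
    · exact ⟨⟨inferInstance, bot_le⟩, fun I hI hIJ =>
        have := hI.1
        ((IsArtinianRing.isMaximal_of_isPrime I).eq_of_le hJ.ne_top hIJ).ge⟩
  have hspan := hreg.spanFinrank_maximalIdeal
  rw [h0] at hspan
  have h1 : (maximalIdeal (Localization.AtPrime J)).spanFinrank = 0 := by exact_mod_cast hspan
  have h2 : maximalIdeal (Localization.AtPrime J) = ⊥ :=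
    (Submodule.spanFinrank_eq_zero_iff_eq_bot (IsNoetherian.noetherian _)).mp h1
  have h3 : IsField (Localization.AtPrime J) := isField_iff_maximalIdeal_eq.mpr h2
  have := h3.isDomain
  infer_instance

/-- If the fiber of a finite algebra `S` over `P` is regular, then `P S` is a radical ideal. The
linear form `τ` and the dual bases `e`, `f` serve to embed `S / P S` into the fiber. -/
theorem mem_map_of_mul_self_mem_of_isRegularRing_fiber {R S ι : Type*} [CommRing R] [CommRing S]
    [Algebra R S] [Module.Finite R S] [Fintype ι] (τ : S →ₗ[R] R) (e f : ι → S)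
    (hf : ∀ x, x = ∑ i, τ (e i * x) • f i) (P : Ideal R) [P.IsPrime]
    (hP : IsRegularRing (P.Fiber S))
    {t : S} (ht : t * t ∈ P.map (algebraMap R S)) : t ∈ P.map (algebraMap R S) := by
  have : IsArtinianRing (P.Fiber S) := IsArtinianRing.of_finite P.ResidueField (P.Fiber S)
  have hred := isReduced_of_isRegularRing_of_isArtinianRing (P.Fiber S)
  let g : S →ₐ[R] P.Fiber S := Algebra.TensorProduct.includeRight
  have h0 : P.map (algebraMap R S) ≤ RingHom.ker g := by
    rw [Ideal.map_le_iff_le_comap]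
    intro r hr
    rw [Ideal.mem_comap, RingHom.mem_ker, AlgHom.commutes,
      IsScalarTower.algebraMap_apply R P.ResidueField (P.Fiber S),
      Ideal.algebraMap_residueField_eq_zero.mpr hr, map_zero]
  have h1 : g t * g t = 0 := by
    rw [← map_mul]; exact h0 ht
  have h2 : (1 : P.ResidueField) ⊗ₜ[R] t = 0 :=
    hred.eq_zero _ ⟨2, by rw [sq]; exact h1⟩
  rw [hf t]
  refine sum_mem fun i _ => ?_
  rw [Algebra.smul_def]
  refine Ideal.mul_mem_right _ _ (Ideal.mem_map_of_mem _ ?_)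
  rw [← Ideal.algebraMap_residueField_eq_zero]
  have h3 := congrArg (TensorProduct.rid R P.ResidueField)
    (congrArg ((τ ∘ₗ LinearMap.mulLeft R (e i)).lTensor P.ResidueField) h2)
  simpa [Algebra.smul_def] using h3

/-- A finite field extension `L` of `K` is a Frobenius algebra; so is `R ⊗[K] L` over `R`. -/
theorem exists_dual_bases_tensorProduct (K L R : Type*) [Field K] [Field L] [Algebra K L]
    [FiniteDimensional K L] [CommRing R] [Algebra K R] :
    ∃ (τ : R ⊗[K] L →ₗ[R] R) (e f : Fin (Module.finrank K L) → R ⊗[K] L),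
      (∀ x, x = ∑ i, τ (x * f i) • e i) ∧ ∀ x, x = ∑ i, τ (e i * x) • f i := by
  obtain ⟨τ₀, hτ₀⟩ := LinearMap.exists_leftInverse_of_injective (Algebra.linearMap K L)
    (LinearMap.ker_eq_bot.mpr (algebraMap K L).injective)
  have hτ₁ : τ₀ 1 = 1 := by simpa using LinearMap.congr_fun hτ₀ 1
  let B : LinearMap.BilinForm K L := (LinearMap.mul K L).compr₂ τ₀
  have hB (x y : L) : B x y = τ₀ (x * y) := rfl
  have hsymm : B.IsSymm := ⟨fun x y => by rw [hB, hB, mul_comm]⟩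
  have hnondeg : B.Nondegenerate := by
    refine ⟨fun x hx => ?_, fun x hx => ?_⟩ <;> by_contra hx0 <;> have := hx x⁻¹ <;>
      simp [hB, hx0, hτ₁] at this
  let b := Module.finBasis K L
  let b' := B.dualBasis hnondeg b
  have hb' (x : L) : x = ∑ i, τ₀ (b i * x) • b' i := by
    conv_lhs => rw [← b'.sum_repr x]
    simp only [b', LinearMap.BilinForm.dualBasis_repr_apply, hB, mul_comm]
  have hb (x : L) : x = ∑ i, τ₀ (x * b' i) • b i := by
    have h1 := (B.dualBasis hnondeg b').sum_repr x
    simp only [LinearMap.BilinForm.dualBasis_repr_apply, hB] at h1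
    rw [LinearMap.BilinForm.dualBasis_dualBasis hnondeg hsymm b] at h1
    exact h1.symm
  let τ : R ⊗[K] L →ₗ[R] R :=
    (TensorProduct.AlgebraTensorModule.rid K R R).toLinearMap ∘ₗ τ₀.baseChange R
  have hτ (r : R) (x : L) : τ (r ⊗ₜ x) = algebraMap K R (τ₀ x) * r := by
    simp [τ, Algebra.smul_def]
  have hsmul (r : R) (k : K) (y : L) :
      (algebraMap K R k * r) • ((1 : R) ⊗ₜ[K] y) = r ⊗ₜ (k • y) := by
    rw [← Algebra.smul_def, TensorProduct.smul_tmul', smul_eq_mul, mul_one,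
      TensorProduct.smul_tmul]
  refine ⟨τ, fun i => 1 ⊗ₜ b i, fun i => 1 ⊗ₜ b' i, fun x => ?_, fun x => ?_⟩
  · induction x with
    | zero => simp
    | tmul r x =>
      simp only [Algebra.TensorProduct.tmul_mul_tmul, mul_one, hτ, hsmul]
      rw [← TensorProduct.tmul_sum, ← hb]
    | add x y hx hy =>
      simp only [add_mul, map_add, add_smul, Finset.sum_add_distrib]
      rw [← hx, ← hy]
  · induction x with
    | zero => simp
    | tmul r x =>
      simp only [Algebra.TensorProduct.tmul_mul_tmul, one_mul, hτ, hsmul]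
      rw [← TensorProduct.tmul_sum, ← hb']
    | add x y hx hy =>
      simp only [mul_add, map_add, add_smul, Finset.sum_add_distrib]
      rw [← hx, ← hy]

end Fibers

section Localization

variable {R : Type u} {S : Type v} [CommRing R] [CommRing S] [Algebra R S]

theorem hasIncomparability_localization [Algebra.IsIntegral R S] {A B : Type*} [CommRing A]
    [CommRing B] [Algebra R A] [Algebra S B] [Algebra A B] [Algebra R B] [IsScalarTower R A B]
    [IsScalarTower R S B] (M : Submonoid S) [IsLocalization M B] : HasIncomparability A B := by
  intro I J hI hJ hIJ hcomap
  apply (IsLocalization.orderEmbedding M B).injective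
  change I.comap (algebraMap S B) = J.comap (algebraMap S B)
  refine le_antisymm (Ideal.comap_mono hIJ) fun x hx => ?_
  by_contra hxI
  have h1 := Ideal.comap_lt_comap_of_integral_mem_sdiff (R := R) (Ideal.comap_mono hIJ)
    ⟨hx, hxI⟩ (Algebra.IsIntegral.isIntegral x)
  rw [Ideal.comap_comap, Ideal.comap_comap, ← IsScalarTower.algebraMap_eq,
    IsScalarTower.algebraMap_eq R A B, ← Ideal.comap_comap, ← Ideal.comap_comap, hcomap] at h1
  exact lt_irrefl _ h1

theorem faithfullyFlat_localization [Module.Flat R S] (P : Ideal R) (Q : Ideal S) [P.IsPrime]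
    [Q.IsPrime] [Q.LiesOver P] [Algebra (Localization.AtPrime P) (Localization.AtPrime Q)]
    [Localization.AtPrime.IsLiesOverAlgebra P Q] :
    Module.FaithfullyFlat (Localization.AtPrime P) (Localization.AtPrime Q) := by
  have : Module.Flat (Localization.AtPrime P) (Localization.AtPrime Q) := by
    infer_instance
  exact Module.FaithfullyFlat.of_flat_of_isLocalHom

end Localization

/-! ### Ascent from a ring to its base change -/

section Ascent

theorem charP_of_faithfullyFlat (p : ℕ) {A B : Type*} [CommRing A] [CommRing B] [Algebra A B]
    [Module.FaithfullyFlat A B] [CharP A p] : CharP B p :=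
  charP_of_injective_algebraMap (FaithfulSMul.algebraMap_injective A B) p

variable (p : ℕ) [Fact p.Prime] {R : Type u} {S : Type v} [CommRing R] [CommRing S] [Algebra R S]

instance [CharP R p] [CharP S p] :
    Algebra (FrobeniusPushforward p R) (FrobeniusPushforward p S) :=
  inferInstanceAs (Algebra R S)

/-- Purity of the Frobenius endomorphism ascends along flat local extensions that come from
localizing a Frobenius extension with reduced closed fiber. -/
theorem isPureHom_frobenius_of_fiber {A : Type u} {B : Type v} {ι : Type*} [CommRing A] [CommRing B]
    [Algebra R A] [Algebra S B] [Algebra A B] [Algebra R B] [IsScalarTower R A B]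
    [IsScalarTower R S B] [Fintype ι] (τ : S →ₗ[R] R) (e f : ι → S)
    (he : ∀ x, x = ∑ i, τ (x * f i) • e i) (hf : ∀ x, x = ∑ i, τ (e i * x) • f i)
    (P : Ideal R) [P.IsPrime] (Q : Ideal S) [Q.IsPrime] [IsLocalization.AtPrime A P]
    [IsLocalization.AtPrime B Q] [IsLocalRing A] [IsLocalRing B] [Module.FaithfullyFlat A B]
    (hred : ∀ t : S, t * t ∈ P.map (algebraMap R S) → t ∈ P.map (algebraMap R S))
    [CharP A p] [CharP B p] (hA : IsPureHom (frobenius A p)) : IsPureHom (frobenius B p) := by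
  have : IsLocalHom (algebraMap A B) := Module.FaithfullyFlat.isLocalHom A B
  have hFF : Module.FaithfullyFlat (FrobeniusPushforward p A) (FrobeniusPushforward p B) :=
    inferInstanceAs (Module.FaithfullyFlat A B)
  let _ : Algebra A (FrobeniusPushforward p B) :=
    ((algebraMap B (FrobeniusPushforward p B)).comp (algebraMap A B)).toAlgebra
  have : IsScalarTower A B (FrobeniusPushforward p B) := IsScalarTower.of_algebraMap_eq' rfl
  have : IsScalarTower A (FrobeniusPushforward p A) (FrobeniusPushforward p B) :=
    IsScalarTower.of_algebraMap_eq fun a =>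
      ((algebraMap A B).map_frobenius p a).symm
  rw [isPureHom_frobenius_iff] at hA ⊢
  exact IsPureAlgebra.of_faithfullyFlat hA fun N _ _ n hn hmn =>
    exists_linearMap_tensorProduct τ e f he hf P Q hred N n hn hmn

/-- `F`-purity ascends along finite flat Frobenius extensions with regular fibers. -/
theorem IsFPure.of_hasRegularFibers {ι : Type*} [Fintype ι] [IsNoetherianRing R] [Module.Finite R S]
    [Module.Flat R S] (τ : S →ₗ[R] R) (e f : ι → S) (he : ∀ x, x = ∑ i, τ (x * f i) • e i)
    (hf : ∀ x, x = ∑ i, τ (e i * x) • f i) (hfib : HasRegularFibers R S) (hR : IsFPure p R) :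
    IsFPure p S := by
  intro Q _
  let _ := Localization.AtPrime.algebraOfLiesOver (Q.under R) Q
  have := faithfullyFlat_localization (Q.under R) Q
  have hA := hR (Q.under R)
  have := hA.charP
  have hcharP : CharP (Localization.AtPrime Q) p :=
    charP_of_faithfullyFlat p (A := Localization.AtPrime (Q.under R))
  have := IsNoetherianRing.of_finite R S
  exact ⟨inferInstance, inferInstance, hcharP,
    isPureHom_frobenius_of_fiber p (A := Localization.AtPrime (Q.under R)) τ e f he hf (Q.under R) Q
      (fun t ht => mem_map_of_mul_self_mem_of_isRegularRing_fiber τ e f hf _ (hfib _) ht)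
      hA.isPureHom_frobenius⟩

/-- `F`-rationality ascends along finite flat extensions `S` of `R` such that a power of the
Frobenius of `S` factors through `R`, if `S` is `F`-pure. -/
theorem IsFRational.of_pow_mem_range [IsNoetherianRing R] [Module.Finite R S] [Module.Flat R S]
    (n : ℕ) (hpow : ∀ s : S, s ^ p ^ n ∈ (algebraMap R S).range) (hR : IsFRational p R)
    (hS : IsFPure p S) : IsFRational p S := by
  intro Q _
  let _ := Localization.AtPrime.algebraOfLiesOver (Q.under R) Q
  have := faithfullyFlat_localization (Q.under R) Q
  have hA := hR (Q.under R)
  have hB := hS Q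
  have := hA.charP
  have := hB.charP
  have := IsNoetherianRing.of_finite R S
  set A := Localization.AtPrime (Q.under R)
  set B := Localization.AtPrime Q
  have hinc : HasIncomparability A B := hasIncomparability_localization (R := R) (S := S)
    Q.primeCompl
  refine ⟨hB.charP, hA.isCohenMacaulay.of_hasIncomparability hinc, fun I hI => ?_⟩
  refine tightClosure_eq_of_pow_mem_range p hinc hA.tightClosure_eq hB.isPureHom_frobenius n ?_ hI
  intro b
  obtain ⟨⟨s, y⟩, hs⟩ := IsLocalization.surj Q.primeCompl b
  simp only at hs
  obtain ⟨r, hr⟩ := hpow s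
  obtain ⟨r', hr'⟩ := hpow y
  have hr'Q : r' ∉ Q.under R := fun h => by
    have h1 : (y : S) ^ p ^ n ∈ Q := hr' ▸ Ideal.mem_comap.mp h
    exact y.2 (Ideal.IsPrime.mem_of_pow_mem inferInstance _ h1)
  have hunit : IsUnit (algebraMap R A r') :=
    IsLocalization.map_units A (⟨r', hr'Q⟩ : (Q.under R).primeCompl)
  obtain ⟨a, ha⟩ := hunit.exists_right_inv
  have h2 (x : R) : algebraMap A B (algebraMap R A x) = algebraMap S B (algebraMap R S x) := by
    rw [← IsScalarTower.algebraMap_apply, ← IsScalarTower.algebraMap_apply]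
  refine ⟨algebraMap R A r * a, ?_⟩
  rw [map_mul, h2, hr, map_pow, ← hs, mul_pow, ← map_pow, ← hr', ← h2, mul_assoc, ← map_mul, ha,
    map_one, mul_one]

/-- `F`-rationality ascends along finite free extensions `S` of `R` with a basis whose
`p ^ e`-th powers form bases for all `e`. -/
theorem IsFRational.of_basis [IsNoetherianRing R] {ι : Type*} [Finite ι] (b : Module.Basis ι R S)
    (hb : ∀ e : ℕ, ∃ b' : Module.Basis ι R S, ∀ i, b' i = b i ^ p ^ e) (hR : IsFRational p R) :
    IsFRational p S := by
  have := Fintype.ofFinite ι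
  have := Module.Free.of_basis b
  have := Module.Finite.of_basis b
  intro Q _
  let _ := Localization.AtPrime.algebraOfLiesOver (Q.under R) Q
  have := faithfullyFlat_localization (Q.under R) Q
  have hA := hR (Q.under R)
  have := hA.charP
  have hcharP : CharP (Localization.AtPrime Q) p :=
    charP_of_faithfullyFlat p (A := Localization.AtPrime (Q.under R))
  have := IsNoetherianRing.of_finite R S
  let A := Localization.AtPrime (Q.under R)
  let B := Localization.AtPrime Q
  -- the semilocal ring `S_P` between `S` and `S_Q`
  let M := Algebra.algebraMapSubmonoid S (Q.under R).primeCompl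
  let T := Localization M
  have hM : M ≤ Q.primeCompl := by
    rintro _ ⟨r, hr, rfl⟩
    exact hr
  let g : T →ₐ[S] B := IsLocalization.liftAlgHom (M := M) (f := Algebra.ofId S B)
    fun y => IsLocalization.map_units (M := Q.primeCompl) B ⟨y, hM y.2⟩
  let _ : Algebra T B := g.toRingHom.toAlgebra
  have : IsScalarTower S T B := IsScalarTower.of_algebraMap_eq fun s => (g.commutes s).symm
  have : IsScalarTower R T B := .to₁₃₄ _ S _ _
  have : IsScalarTower A T B := .of_algebraMap_eq' <| by
    apply IsLocalization.ringHom_ext (Q.under R).primeCompl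
    simp only [RingHom.comp_assoc, ← IsScalarTower.algebraMap_eq]
  have hloc : IsLocalization (Algebra.algebraMapSubmonoid T Q.primeCompl) B :=
    .isLocalization_of_submonoid_le _ _ M _ hM
  have hinc : HasIncomparability A B := hasIncomparability_localization (R := R) (S := S)
    Q.primeCompl
  let bT : Module.Basis ι A T := b.localizationLocalization A (Q.under R).primeCompl T
  have hbT : ∀ e : ℕ, ∃ b' : Module.Basis ι A T, ∀ i, b' i = bT i ^ p ^ e := fun e => by
    obtain ⟨b', hb'⟩ := hb e
    exact ⟨b'.localizationLocalization A (Q.under R).primeCompl T, fun i => by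
      simp [bT, Module.Basis.localizationLocalization_apply, hb']⟩
  have : Module.Finite A T := Module.Finite.of_basis bT
  let QT : Ideal T := (maximalIdeal B).comap (algebraMap T B)
  have hQT : QT.comap (algebraMap A T) = maximalIdeal A := by
    rw [Ideal.comap_comap, ← IsScalarTower.algebraMap_eq, comap_maximalIdeal_of_faithfullyFlat]
  have : QT.IsMaximal := Ideal.isMaximal_of_isIntegral_of_isMaximal_comap (R := A) QT <| by
    rw [hQT]; infer_instance
  have : IsLocalization.AtPrime B QT := by
    refine IsLocalization.of_le (Algebra.algebraMapSubmonoid T Q.primeCompl) _ ?_ ?_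
    · rintro _ ⟨s, hs, rfl⟩ hsQ
      rw [SetLike.mem_coe, Ideal.mem_comap, ← IsScalarTower.algebraMap_apply] at hsQ
      exact (mem_maximalIdeal _).mp hsQ
        (IsLocalization.map_units B (⟨s, hs⟩ : Q.primeCompl))
    · intro t ht
      exact notMem_maximalIdeal.mp ht
  have : IsNoetherianRing T := IsLocalization.isNoetherianRing M T inferInstance
  have : CharP T p := charP_of_injective_algebraMap (R := A) (A := T) (fun x y hxy =>
    FaithfulSMul.algebraMap_injective A B (by
      rw [IsScalarTower.algebraMap_apply A T B, hxy, ← IsScalarTower.algebraMap_apply])) p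
  have hCM : IsCohenMacaulayLocalRing B := hA.isCohenMacaulay.of_hasIncomparability hinc
  refine ⟨hcharP, hCM, fun I hI => ?_⟩
  refine tightClosure_eq_of_forall_isSystemOfParameters p (fun zs hzs => ?_) hI
  refine tightClosure_subset_of_forall_map p hinc hCM (fun xs hxs => ?_) zs []
    (by simpa using hzs)
  rintro z ⟨c, hc, N, hN⟩
  obtain ⟨a, ha, d, hd⟩ := hinc.exists_mem_compMinimalPrimes hc
  have hprim := (hxs.map hinc (B := B)).2
  rw [← Ideal.map_ofList] at hprim hN ⊢
  obtain ⟨n, hn⟩ := Ideal.exists_radical_pow_le_of_fg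
    ((Ideal.ofList xs).map (algebraMap A B)) (IsNoetherian.noetherian _)
  rw [hprim] at hn
  refine mem_map_of_forall_mul_pow_mem_bracketPower p bT hbT QT
    (hA.tightClosure_eq _ ⟨xs, [], by simpa using hxs, rfl⟩) n hn ha N fun k hk => ?_
  rw [hd, mul_comm c, mul_assoc]
  exact Ideal.mul_mem_left _ _ (hN k hk)

end Ascent

section Main

attribute [local instance] Algebra.TensorProduct.rightAlgebra

/-- Base change along a separable extension of fields preserves `F`-rationality. -/
theorem IsFRational.tensorProduct_of_isSeparable (p : ℕ) [Fact p.Prime] (K L R : Type*) [Field K]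
    [CharP K p] [Field L] [Algebra K L] [FiniteDimensional K L] [Algebra.IsSeparable K L]
    [CommRing R] [Algebra K R] [IsNoetherianRing R] (hR : IsFRational p R) :
    IsFRational p (R ⊗[K] L) := by
  refine hR.of_basis p ((Module.finBasis K L).baseChange R) fun e => ?_
  exact ⟨((Module.finBasis K L).mapPowExpCharPowOfIsSeparable p e).baseChange R, fun i => by
    simp [Module.Basis.baseChange_apply, Module.Basis.mapPowExpCharPowOfIsSeparable]⟩

variable (K F L R : Type*) [Field K] [Field F] [Field L] [Algebra K F] [Algebra F L] [Algebra K L]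
  [IsScalarTower K F L] [CommRing R] [Algebra K R]

/-- The map `R ⊗[K] F → R ⊗[K] L` for a tower of fields `K ⊆ F ⊆ L`. -/
noncomputable def tensorTowerMap : R ⊗[K] F →ₐ[R] R ⊗[K] L :=
  Algebra.TensorProduct.map (AlgHom.id R R) (IsScalarTower.toAlgHom K F L)

/-- For a finite purely inseparable extension `L / F`, a power of the Frobenius of `R ⊗[K] L`
factors through `R ⊗[K] F`. -/
theorem exists_pow_mem_range_tensorTowerMap (p : ℕ) [Fact p.Prime] [CharP K p]
    [FiniteDimensional F L] [IsPurelyInseparable F L] :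
    ∃ n : ℕ, ∀ s : R ⊗[K] L, s ^ p ^ n ∈ (tensorTowerMap K F L R).range := by
  have : CharP F p := charP_of_injective_algebraMap (algebraMap K F).injective p
  refine ⟨IsPurelyInseparable.exponent F L, fun s => ?_⟩
  induction s with
  | zero => rw [zero_pow (pow_pos (Fact.out : p.Prime).pos _).ne']; exact zero_mem _
  | tmul r x =>
    obtain ⟨y, hy⟩ := IsPurelyInseparable.exponent_def' F p x
    exact ⟨(r ^ p ^ _) ⊗ₜ y, by
      rw [Algebra.TensorProduct.tmul_pow, ← hy]; rfl⟩
  | add x y hx hy =>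
    by_cases hsub : Subsingleton (R ⊗[K] L)
    · rw [Subsingleton.elim ((x + y) ^ _) 0]; exact zero_mem _
    · have := not_subsingleton_iff_nontrivial.mp hsub
      have : CharP (R ⊗[K] L) p :=
        charP_of_injective_algebraMap (algebraMap K (R ⊗[K] L)).injective p
      rw [add_pow_char_pow]
      exact add_mem hx hy

/-- `R ⊗[K] L` is the base change of `L` from `F` to `R ⊗[K] F`, hence flat over it. -/
theorem flat_tensorTowerMap : (tensorTowerMap K F L R).toRingHom.Flat := by
  let _ : Algebra (R ⊗[K] F) (R ⊗[K] L) := (tensorTowerMap K F L R).toRingHom.toAlgebra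
  have : IsScalarTower R (R ⊗[K] F) (R ⊗[K] L) :=
    IsScalarTower.of_algebraMap_eq fun r => ((tensorTowerMap K F L R).commutes r).symm
  let _ : Algebra F (R ⊗[K] L) := ((algebraMap L (R ⊗[K] L)).comp (algebraMap F L)).toAlgebra
  have : IsScalarTower F L (R ⊗[K] L) := IsScalarTower.of_algebraMap_eq' rfl
  have : IsScalarTower F (R ⊗[K] F) (R ⊗[K] L) :=
    IsScalarTower.of_algebraMap_eq (R := F) (S := R ⊗[K] F) (A := R ⊗[K] L) fun x => by
      change (1 : R) ⊗ₜ[K] algebraMap F L x = tensorTowerMap K F L R (1 ⊗ₜ x)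
      simp [tensorTowerMap]
  have : IsScalarTower K (R ⊗[K] F) (R ⊗[K] L) := .to₁₃₄ _ R _ _
  have h : Algebra.IsPushout F L (R ⊗[K] F) (R ⊗[K] L) :=
    (Algebra.IsPushout.comp_iff (R := K) (S := F) (R' := R) (S' := R ⊗[K] F) (T := L)).mp
      inferInstance
  exact Module.Flat.isBaseChange F (R ⊗[K] F) L (R ⊗[K] L) h.symm.out

/-- The property of being `F`-rational ascends from `R` to `R ⊗[K] L` through the separable part
`F / K` and the purely inseparable part `L / F` of `L / K`, if `R ⊗[K] L` is `F`-pure. Here the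
field `F` is unrelated to the `F` in `F`-rational and `F`-pure. -/
theorem IsFRational.tensorProduct_of_isFPure (p : ℕ) [Fact p.Prime] [CharP K p]
    [FiniteDimensional K F] [FiniteDimensional F L] [FiniteDimensional K L]
    [Algebra.IsSeparable K F] [IsPurelyInseparable F L] [IsNoetherianRing R]
    (hR : IsFRational p R) (hS : IsFPure p (R ⊗[K] L)) : IsFRational p (R ⊗[K] L) := by
  let _ : Algebra (R ⊗[K] F) (R ⊗[K] L) := (tensorTowerMap K F L R).toRingHom.toAlgebra
  have : IsScalarTower R (R ⊗[K] F) (R ⊗[K] L) :=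
    IsScalarTower.of_algebraMap_eq fun r => ((tensorTowerMap K F L R).commutes r).symm
  have : Module.Finite (R ⊗[K] F) (R ⊗[K] L) :=
    Module.Finite.of_restrictScalars_finite R (R ⊗[K] F) (R ⊗[K] L)
  have : Module.Flat (R ⊗[K] F) (R ⊗[K] L) := flat_tensorTowerMap K F L R
  have : IsNoetherianRing (R ⊗[K] F) := IsNoetherianRing.of_finite R (R ⊗[K] F)
  obtain ⟨n, hn⟩ := exists_pow_mem_range_tensorTowerMap K F L R p
  exact (hR.tensorProduct_of_isSeparable p K F R).of_pow_mem_range p n hn hS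

end Main

end FSing

theorem mainTheorem4 (p : ℕ) [Fact p.Prime]
    (K : Type u) (L : Type v) (R : Type w)
    [Field K] [CharP K p] [Field L] [Algebra K L] [FiniteDimensional K L]
    [CommRing R] [Algebra K R] [Algebra.FiniteType K R]
    (hfib : FSing.HasRegularFibers R (R ⊗[K] L))
    (hrat : FSing.IsFRational p R) (hpure : FSing.IsFPure p R) :
    FSing.IsFRational p (R ⊗[K] L) ∧ FSing.IsFPure p (R ⊗[K] L) := by
  have : IsNoetherianRing R := Algebra.FiniteType.isNoetherianRing K R
  obtain ⟨τ, e, f, he, hf⟩ := FSing.exists_dual_bases_tensorProduct K L R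
  have hS : FSing.IsFPure p (R ⊗[K] L) := hpure.of_hasRegularFibers p τ e f he hf hfib
  exact ⟨hrat.tensorProduct_of_isFPure K (separableClosure K L) L R p hS, hS⟩
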